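/- **Setting.** Let $d\ge 1$ and $N$ be natural numbers and let $D,B,P,\sigma>0$ be reals; put $\mathtt{SNR}=P/\sigma^2$. Write $\log$ for the logarithm to base $2$ and $\|\cdot\|$ for the Euclidean norm. *Oracles.* Let $\mathcal X\subset\mathbb R^d$ be a nonempty closed convex set with $\sup_{x,y\in\mathcal X}\|x-y\|\le D$. Let $\mathcal O$ be the set of pairs $(f,O)$ of a convex function $f:\mathcal X\to\mathbb R$ and a first-order oracle $O$ that answers each query $x\in\mathcal X$, with fresh independent randomness, by a random vector $\hat g(x)\in\mathbb R^d$ with $\mathbb E[\hat g(x)]\in\partial f(x)$ and $\mathbb E\|\hat g(x)\|^2\le B^2$, where $\partial f(x)=\{g: f(y)\ge f(x)+\langle g,y-x\rangle\ \forall y\in\mathcal X\}$. *Protocols.* An over-the-air optimization protocol $(\pi,\varphi)$ with at most $N$ channel uses consists of a code length $\ell$ and a number $T$ of queries with $\ell T\le N$, public randomness $U=(U_1,\dots,U_T)$ (of any joint law, independent of the oracle and of the channel), an encoder $\varphi$ which maps a gradient estimate and the public randomness to a codeword in $\mathbb R^\ell$ and satisfies the average power constraint $\mathbb E\|\varphi(\hat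 g,U_t)\|^2\le \ell P$ for every $t$ and every random vector $\hat g$ independent of $U$ with $\mathbb E\|\hat g\|^2\le B^2$, and an algorithm $\pi$. In iteration $t=1,\dots,T$, the algorithm chooses a query $x_t\in\mathcal X$ as a function of $U$ and $Y_1,\dots,Y_{t-1}$, the oracle supplies $\hat g_t=\hat g(x_t)$, and the algorithm receives $Y_t=\varphi(\hat g_t,U_t)+Z_t\in\mathbb R^\ell$, where all coordinates of all $Z_t$ are i.i.d. Gaussian with mean $0$ and variance $\sigma^2$. In the end the algorithm outputs a point $\hat x\in\mathcal X$ that is a function of $U$ and $Y_1,\dots,Y_T$. Its convergence error is $\mathcal E(f,\pi^{\varphi O})=\mathbb E f(\hat x)-\min_{x\in\mathcal X}f(x)$. *Min-max error.* Let $$\mathcal E^*(N)=\sup_{\mathcal X}\ \inf_{(\pi,\varphi)}\ \sup_{(f,O)\in\mathcal O}\mathcal E(f,\pi^{\varphi O}),$$ with $\mathcal X$ ranging over the sets above and $(\pi,\varphi)$ over the protocols on $\mathcal X$ with at most $N$ channel uses. **Theorem.** There is a universal constant $c\in(0,1)$ such that, for all $d\ge1$, $D,B,P,\sigma>0$ and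 all $N\ge \dfrac{d}{\log(1+\mathtt{SNR})}$, $$\mathcal E^*(N)\ \ge\ \frac{c\,D\,B}{\sqrt N}\cdot\sqrt{\frac{d}{\min\{d,\ \tfrac12\log(1+\mathtt{SNR})\}}}.$$ -/

import Mathlib

open MeasureTheory ProbabilityTheory
open scoped ENNReal

noncomputable section

namespace OverTheAir

/-- The domains of optimization: the nonempty closed convex sets of diameter at most `D` in `ℝ^d`. -/
structure IsFeasibleSet {d : ℕ} (D : ℝ) (X : Set (EuclideanSpace ℝ (Fin d))) : Prop where
  nonempty : X.Nonempty
  closed : IsClosed X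
  convex : Convex ℝ X
  diam_le : ∀ x ∈ X, ∀ y ∈ X, ‖x - y‖ ≤ D

/-- The set `∂f(x)` of subgradients at `x` of a function `f` on the domain `X`. -/
def subdifferential {d : ℕ} (X : Set (EuclideanSpace ℝ (Fin d)))
    (f : EuclideanSpace ℝ (Fin d) → ℝ) (x : EuclideanSpace ℝ (Fin d)) :
    Set (EuclideanSpace ℝ (Fin d)) :=
  {g | ∀ y ∈ X, f x + inner ℝ g (y - x) ≤ f y}

/-- A pair `(f, O)` of a convex function on `X` and a first order oracle for it. Only the values
of `f` on `X` matter. The oracle answers the query `x` by `grad (x, W)`, where the seed `W` of law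
`seedLaw` is drawn afresh at each query. -/
structure FunctionOracle {d : ℕ} (X : Set (EuclideanSpace ℝ (Fin d))) (B : ℝ) where
  f : EuclideanSpace ℝ (Fin d) → ℝ
  convexOn : ConvexOn ℝ X f
  Seed : Type
  [seedMeasurable : MeasurableSpace Seed]
  seedLaw : Measure Seed
  [seedProbability : IsProbabilityMeasure seedLaw]
  grad : X × Seed → EuclideanSpace ℝ (Fin d)
  measurable_grad : Measurable grad
  /-- unbiasedness (the integral exists by the next field) -/
  unbiased : ∀ x : X, (∫ w, grad (x, w) ∂seedLaw) ∈ subdifferential X f x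
  /-- mean square boundedness -/
  meanSquare : ∀ x : X, ∫⁻ w, ‖grad (x, w)‖ₑ ^ 2 ∂seedLaw ≤ ENNReal.ofReal (B ^ 2)

attribute [instance] FunctionOracle.seedMeasurable FunctionOracle.seedProbability

/-- The average power constraint for an encoder `φ` of length `ℓ` whose public randomness `U` has
law `μ`: `E ‖φ(g, U)‖² ≤ ℓ P` for every random vector `g`, independent of `U`, that an oracle with
mean square bound `B` may supply. -/
def PowerConstraint {d ℓ : ℕ} {R : Type} [MeasurableSpace R] (B P : ℝ)
    (φ : EuclideanSpace ℝ (Fin d) × R → EuclideanSpace ℝ (Fin ℓ)) (μ : Measure R) : Prop :=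
  ∀ ν : Measure (EuclideanSpace ℝ (Fin d)), IsProbabilityMeasure ν →
    ∫⁻ g, ‖g‖ₑ ^ 2 ∂ν ≤ ENNReal.ofReal (B ^ 2) →
      ∫⁻ g, ∫⁻ u, ‖φ (g, u)‖ₑ ^ 2 ∂μ ∂ν ≤ ENNReal.ofReal (ℓ * P)

/-- An over-the-air optimization protocol `(π, φ)` on the domain `X` with at most `N` channel uses:
a code of length `ℓ` with encoder `φ` and an algorithm that makes `T` queries, `ℓ * T ≤ N`.

The public randomness is a sequence `U = (U_1, …, U_T)` of arbitrary joint law; the `t`-th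
gradient estimate is encoded with `U_t`. A constant sequence is a single random draw used in all
iterations, an independent sequence is fresh randomness in each of them. The algorithm knows `U`;
its `t`-th query depends on `U` and on the channel outputs before time `t`, its final output on
`U` and on all `T` channel outputs. -/
structure Protocol {d : ℕ} (X : Set (EuclideanSpace ℝ (Fin d))) (B P : ℝ) (N : ℕ) where
  ℓ : ℕ
  T : ℕ
  channelUses : ℓ * T ≤ N
  R : Type
  [randMeasurable : MeasurableSpace R]
  randLaw : Measure (Fin T → R)
  [randProbability : IsProbabilityMeasure randLaw]
  encoder : EuclideanSpace ℝ (Fin d) × R → EuclideanSpace ℝ (Fin ℓ)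
  measurable_encoder : Measurable encoder
  power : ∀ t : Fin T, PowerConstraint B P encoder (randLaw.map fun u => u t)
  query : (t : Fin T) → (Fin T → R) × (Fin t → Fin ℓ → ℝ) → X
  measurable_query : ∀ t, Measurable (query t)
  output : (Fin T → R) × (Fin T → Fin ℓ → ℝ) → X
  measurable_output : Measurable output

attribute [instance] Protocol.randMeasurable Protocol.randProbability

variable {d : ℕ} {X : Set (EuclideanSpace ℝ (Fin d))} {B P : ℝ} {N : ℕ}

/-- The channel outputs of the first `t` iterations, given the public randomness `u`, the seeds
`w` of the oracle, and the channel noise `z`. -/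
def channelOutputs (p : Protocol X B P N) (O : FunctionOracle X B)
    (u : Fin p.T → p.R) (w : Fin p.T → O.Seed) (z : Fin p.T → Fin p.ℓ → ℝ) :
    (t : ℕ) → t ≤ p.T → (Fin t → Fin p.ℓ → ℝ)
  | 0, _ => Fin.elim0
  | t + 1, h =>
    let past := channelOutputs p O u w z t (Nat.le_of_succ_le h)
    let s : Fin p.T := ⟨t, h⟩
    let x := p.query s (u, past)
    let codeword := p.encoder (O.grad (x, w s), u s)
    Fin.snoc (α := fun _ => Fin p.ℓ → ℝ) past (fun i => codeword i + z s i)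

/-- The joint law of public randomness, oracle seeds and channel noise: the three are independent,
the seeds are i.i.d., and the noise is i.i.d. Gaussian with mean `0` and variance `σ²`. -/
def runLaw (p : Protocol X B P N) (O : FunctionOracle X B) (σ : ℝ) :
    Measure ((Fin p.T → p.R) × (Fin p.T → O.Seed) × (Fin p.T → Fin p.ℓ → ℝ)) :=
  p.randLaw.prod ((Measure.pi fun _ => O.seedLaw).prod
    (Measure.pi fun _ => Measure.pi fun _ => gaussianReal 0 (Real.toNNReal (σ ^ 2))))

/-- The point of `X` returned at the end of the run. -/
def finalPoint (p : Protocol X B P N) (O : FunctionOracle X B)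
    (ω : (Fin p.T → p.R) × (Fin p.T → O.Seed) × (Fin p.T → Fin p.ℓ → ℝ)) : X :=
  p.output (ω.1, channelOutputs p O ω.1 ω.2.1 ω.2.2 p.T le_rfl)

/-- The convergence error `E f(x_T) - min_X f`. On a domain `X`, the function `f` of a pair
`(f, O)` is Lipschitz and bounded, so that the expectation and the minimum exist. -/
def convergenceError (p : Protocol X B P N) (O : FunctionOracle X B) (σ : ℝ) : ℝ :=
  (∫ ω, O.f (finalPoint p O ω) ∂(runLaw p O σ)) - ⨅ x : X, O.f x

/-- `E*(N, X)`, the infimum over protocols of the worst-case convergence error. -/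
def minmaxErrorOn (X : Set (EuclideanSpace ℝ (Fin d))) (B P σ : ℝ) (N : ℕ) : EReal :=
  ⨅ p : Protocol X B P N, ⨆ O : FunctionOracle X B, (convergenceError p O σ : EReal)

/-- `E*(N)`, the supremum of `E*(N, X)` over the domains `X` of diameter at most `D` in `ℝ^d`. -/
def minmaxError (d : ℕ) (D B P σ : ℝ) (N : ℕ) : EReal :=
  ⨆ (X : Set (EuclideanSpace ℝ (Fin d))) (_ : IsFeasibleSet D X), minmaxErrorOn X B P σ N

end OverTheAir

end

/-! The hard domain is the cube of side `D / √d`. The hard functions are linear with gradient `-δ b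
v`, where `v` is an unknown sign vector and `b = B / √d`; whatever the query, the oracle returns a
random vector with entries `±b` and bias `δ` towards this gradient. Queries are then useless: given
the public randomness, the channel outputs are independent, each with a finite Gaussian mixture as
density. A small error forces the output point to correlate with `v`, so it remains to show that `N`
channel uses cannot reveal most of the signs (Assouad's method).

Flipping one sign multiplies the law of the oracle's answer by `1 - δ · score`, hence the output
density by `1 - δ m_i(y)`, where `m_i` is the posterior mean of the `i`-th score. The squared
Hellinger distance of the two output laws is therefore at most `δ² E m_i²`, and these distances add
up over iterations (`integral_abs_prod_sub_prod_le`). The sum `∑ i, E m_i²` for one iteration has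
two bounds. Scores are bounded by 4, so it is at most `16 d` (`scoreInformation_le_dim`). Scores are
also independent and subgaussian, so by entropy duality it is at most a constant times the relative
entropy of the channel outputs from a centred Gaussian of variance `σ² + P`, which after averaging
the power over the public randomness is at most `ℓ / 2 · log (1 + SNR)`
(`integral_sum_sq_posteriorMean_le`).

Over all iterations the signs stay hidden when `δ² N min {d, ½ log (1 + SNR)}` is at most a small
multiple of `d`. The largest such `δ` gives an error of order `D B δ`, which is the claimed rate. -/

namespace OverTheAir

open scoped NNReal

/-! ### Gaussian product densities and their relative entropy. -/

section Density

lemma pi_withDensity_ofReal {ι : Type*} [Fintype ι] {E : ι → Type*}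
    {mE : ∀ i, MeasurableSpace (E i)} (μ : ∀ i, Measure (E i)) [∀ i, SigmaFinite (μ i)]
    (f : ∀ i, E i → ℝ) (hf : ∀ i x, 0 ≤ f i x) (hint : ∀ i, Integrable (f i) (μ i)) :
    Measure.pi (fun i => (μ i).withDensity fun x => ENNReal.ofReal (f i x)) =
      (Measure.pi μ).withDensity fun x => ENNReal.ofReal (∏ i, f i (x i)) := by
  have hfin : ∀ i, IsFiniteMeasure ((μ i).withDensity fun x => ENNReal.ofReal (f i x)) :=
    fun i => isFiniteMeasure_withDensity_ofReal (hint i).2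
  refine Measure.pi_eq fun s hs => ?_
  rw [withDensity_apply _ (MeasurableSet.univ_pi hs), Measure.restrict_pi_pi,
    ← ofReal_integral_eq_lintegral_ofReal
      (Integrable.fintype_prod_dep fun i => (hint i).restrict)
      (Filter.Eventually.of_forall fun x => Finset.prod_nonneg fun i _ => hf i (x i)),
    integral_fintype_prod_eq_prod,
    ENNReal.ofReal_prod_of_nonneg fun i _ => integral_nonneg (hf i)]
  refine Finset.prod_congr rfl fun i _ => ?_
  rw [withDensity_apply _ (hs i), ofReal_integral_eq_lintegral_ofReal (hint i).restrict
    (Filter.Eventually.of_forall (hf i))]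

/-- The density of a Gaussian vector with mean `a` and independent coordinates of variance `v`. -/
noncomputable def gaussDensity {ι : Type*} [Fintype ι] (v : ℝ≥0) (a y : ι → ℝ) : ℝ :=
  ∏ i, gaussianPDFReal (a i) v (y i)

variable {ι : Type*} [Fintype ι] {v w : ℝ≥0}

lemma gaussDensity_pos (hv : v ≠ 0) (a y : ι → ℝ) : 0 < gaussDensity v a y :=
  Finset.prod_pos fun _ _ => gaussianPDFReal_pos _ _ _ hv

lemma integrable_gaussDensity (v : ℝ≥0) (a : ι → ℝ) : Integrable (gaussDensity v a) :=
  Integrable.fintype_prod fun _ => integrable_gaussianPDFReal _ v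

lemma integral_gaussDensity (hv : v ≠ 0) (a : ι → ℝ) : ∫ y, gaussDensity v a y = 1 := by
  unfold gaussDensity
  rw [integral_fintype_prod_volume_eq_prod fun i => gaussianPDFReal (a i) v]
  simp [integral_gaussianPDFReal_eq_one _ hv]

lemma measurable_gaussDensity (v : ℝ≥0) (a : ι → ℝ) : Measurable (gaussDensity v a) := by
  unfold gaussDensity
  exact Finset.measurable_prod _ fun i _ =>
    (measurable_gaussianPDFReal (a i) v).comp (measurable_pi_apply i)

lemma pi_gaussianReal_eq_withDensity (hv : v ≠ 0) (a : ι → ℝ) :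
    Measure.pi (fun i => gaussianReal (a i) v) =
      volume.withDensity fun y => ENNReal.ofReal (gaussDensity v a y) := by
  simp_rw [gaussianReal_of_var_ne_zero _ hv]
  exact pi_withDensity_ofReal _ _ (fun i x => gaussianPDFReal_nonneg _ _ _)
    fun i => integrable_gaussianPDFReal (a i) v

lemma integral_pi_gaussianReal (hv : v ≠ 0) (a : ι → ℝ) (F : (ι → ℝ) → ℝ) :
    ∫ y, F y ∂(Measure.pi fun i => gaussianReal (a i) v) = ∫ y, gaussDensity v a y * F y := by
  rw [pi_gaussianReal_eq_withDensity hv, integral_withDensity_eq_integral_toReal_smul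
    (measurable_gaussDensity v a).ennreal_ofReal
    (by simp)]
  refine integral_congr_ae (Filter.Eventually.of_forall fun y => ?_)
  simp [ENNReal.toReal_ofReal (gaussDensity_pos hv a y).le]

lemma integrable_gaussDensity_mul (hv : v ≠ 0) (a : ι → ℝ) {F : (ι → ℝ) → ℝ}
    (hF : Integrable F (Measure.pi fun i => gaussianReal (a i) v)) :
    Integrable fun y => gaussDensity v a y * F y := by
  rw [pi_gaussianReal_eq_withDensity hv, integrable_withDensity_iff_integrable_smul'
    (measurable_gaussDensity v a).ennreal_ofReal
    (by simp)] at hF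
  refine hF.congr (Filter.Eventually.of_forall fun y => ?_)
  simp [ENNReal.toReal_ofReal (gaussDensity_pos hv a y).le]

/-- A shift of white Gaussian noise has the product Gaussian density. -/
lemma integral_shift_noise {κ : Type*} [Fintype κ] (hv : v ≠ 0) (c : κ → ι → ℝ)
    (F : (κ → ι → ℝ) → ℝ) (hF : Measurable F) :
    ∫ z, F (fun t i => c t i + z t i)
        ∂(Measure.pi fun _ : κ => Measure.pi fun _ : ι => gaussianReal 0 v) =
      ∫ y, (∏ t, gaussDensity v (c t) (y t)) * F y := by
  have hadd : ∀ t, Measurable fun (z : ι → ℝ) i => c t i + z i := fun t =>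
    measurable_pi_lambda _ fun i => measurable_const.add (measurable_pi_apply i)
  have hadd' : Measurable fun (z : κ → ι → ℝ) t i => c t i + z t i :=
    measurable_pi_lambda _ fun t => (hadd t).comp (measurable_pi_apply t)
  have hshift : (Measure.pi fun _ : κ => Measure.pi fun _ : ι => gaussianReal 0 v).map
      (fun z t i => c t i + z t i) =
      volume.withDensity fun y => ENNReal.ofReal (∏ t, gaussDensity v (c t) (y t)) := by
    have h1 : ∀ t, (Measure.pi fun _ : ι => gaussianReal 0 v).map (fun z i => c t i + z i) =
        volume.withDensity fun y => ENNReal.ofReal (gaussDensity v (c t) y) := by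
      intro t
      have h := Measure.pi_map_pi (μ := fun _ : ι => gaussianReal 0 v)
        (f := fun i x => c t i + x) (fun i => by fun_prop)
      simp_rw [gaussianReal_map_const_add, zero_add] at h
      rw [h, pi_gaussianReal_eq_withDensity hv]
    have : ∀ t, IsFiniteMeasure ((Measure.pi fun _ : ι => gaussianReal 0 v).map
      (fun z i => c t i + z i)) := fun t => inferInstance
    rw [Measure.pi_map_pi (μ := fun _ : κ => Measure.pi fun _ : ι => gaussianReal 0 v)
        (f := fun t z i => c t i + z i) (fun t => (hadd t).aemeasurable)]
    simp_rw [h1]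
    exact pi_withDensity_ofReal _ _ (fun t y => (gaussDensity_pos hv _ _).le)
      fun t => integrable_gaussDensity v (c t)
  have hm : Measurable fun y : κ → ι → ℝ => ∏ t, gaussDensity v (c t) (y t) :=
    Finset.measurable_prod _ fun t _ =>
      (measurable_gaussDensity v (c t)).comp (measurable_pi_apply t)
  rw [← integral_map (φ := fun (z : κ → ι → ℝ) t i => c t i + z t i) (f := F) hadd'.aemeasurable
    hF.aestronglyMeasurable, hshift,
    integral_withDensity_eq_integral_toReal_smul hm.ennreal_ofReal (by simp)]
  refine integral_congr_ae (Filter.Eventually.of_forall fun y => ?_)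
  simp [ENNReal.toReal_ofReal (Finset.prod_nonneg fun t _ => (gaussDensity_pos hv (c t) (y t)).le)]

lemma log_gaussDensity (hv : v ≠ 0) (a y : ι → ℝ) :
    Real.log (gaussDensity v a y) =
      ∑ i, (-(1 / 2) * Real.log (2 * Real.pi * v) - (y i - a i) ^ 2 / (2 * v)) := by
  have hv0 : (0 : ℝ) < v := NNReal.coe_pos.2 (pos_iff_ne_zero.2 hv)
  unfold gaussDensity
  rw [Real.log_prod fun i _ => (gaussianPDFReal_pos _ _ _ hv).ne']
  refine Finset.sum_congr rfl fun i _ => ?_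
  rw [gaussianPDFReal, Real.log_mul (by positivity) (Real.exp_pos _).ne', Real.log_exp,
    Real.log_inv, Real.log_sqrt (by positivity)]
  ring

lemma integrable_sq_sub_gaussianReal (m b : ℝ) :
    Integrable (fun x => (x - b) ^ 2) (gaussianReal m v) :=
  ((memLp_id_gaussianReal 2).sub (memLp_const b)).integrable_sq

lemma integral_sq_sub_gaussianReal (m b : ℝ) :
    ∫ x, (x - b) ^ 2 ∂gaussianReal m v = v + (m - b) ^ 2 := by
  have h := variance_id_gaussianReal (μ := m) (v := v)
  rw [variance_eq_integral aemeasurable_id] at h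
  simp only [id, integral_id_gaussianReal] at h
  have h1 : Integrable (fun x => (x - m) ^ 2) (gaussianReal m v) :=
    integrable_sq_sub_gaussianReal m m
  have h2 : Integrable (fun x : ℝ => x) (gaussianReal m v) :=
    (memLp_id_gaussianReal 1).integrable (by simp)
  have h4 : Integrable (fun x : ℝ => x - m) (gaussianReal m v) := h2.sub (integrable_const m)
  have h3 : Integrable (fun x : ℝ => 2 * (m - b) * (x - m) + (m - b) ^ 2) (gaussianReal m v) :=
    (h4.const_mul _).add (integrable_const _)
  calc ∫ x, (x - b) ^ 2 ∂gaussianReal m v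
      = ∫ x, ((x - m) ^ 2 + (2 * (m - b) * (x - m) + (m - b) ^ 2)) ∂gaussianReal m v := by
        congr 1; ext x; ring
    _ = v + (m - b) ^ 2 := by
        rw [integral_add h1 h3, h, integral_add (h4.const_mul _) (integrable_const _),
          integral_const_mul, integral_sub h2 (integrable_const m)]
        simp

lemma integrable_log_ratio_aux (hv : v ≠ 0) (hw : w ≠ 0) (a : ι → ℝ) :
    Integrable (fun y => Real.log (gaussDensity v a y) - Real.log (gaussDensity w 0 y))
      (Measure.pi fun i => gaussianReal (a i) v) := by
  simp_rw [log_gaussDensity hv, log_gaussDensity hw]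
  refine (integrable_finsetSum _ fun i _ => ?_).sub (integrable_finsetSum _ fun i _ => ?_)
  · exact (integrable_const _).sub (integrable_comp_eval (μ := fun i => gaussianReal (a i) v)
      ((integrable_sq_sub_gaussianReal (a i) (a i)).div_const _))
  · exact (integrable_const _).sub (integrable_comp_eval (μ := fun i => gaussianReal (a i) v)
      (f := fun x => (x - (0 : ι → ℝ) i) ^ 2 / (2 * w))
      ((integrable_sq_sub_gaussianReal (a i) _).div_const _))

lemma integrable_gaussDensity_mul_log_ratio (hv : v ≠ 0) (hw : w ≠ 0) (a : ι → ℝ) :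
    Integrable fun y => gaussDensity v a y *
      (Real.log (gaussDensity v a y) - Real.log (gaussDensity w 0 y)) :=
  integrable_gaussDensity_mul hv a (integrable_log_ratio_aux hv hw a)

/-- The Kullback-Leibler divergence of two Gaussian densities, the second one centred. -/
lemma integral_gaussDensity_mul_log_ratio (hv : v ≠ 0) (hw : w ≠ 0) (a : ι → ℝ) :
    ∫ y, gaussDensity v a y *
        (Real.log (gaussDensity v a y) - Real.log (gaussDensity w 0 y)) =
      Fintype.card ι / 2 * Real.log (w / v) +
        (∑ i, a i ^ 2 - Fintype.card ι * (w - v)) / (2 * w) := by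
  have hv0 : (0 : ℝ) < v := NNReal.coe_pos.2 (pos_iff_ne_zero.2 hv)
  have hw0 : (0 : ℝ) < w := NNReal.coe_pos.2 (pos_iff_ne_zero.2 hw)
  rw [← integral_pi_gaussianReal hv]
  have hi : ∀ i b, Integrable (fun y : ι → ℝ => (y i - b) ^ 2)
      (Measure.pi fun i => gaussianReal (a i) v) := fun i b =>
    integrable_comp_eval (μ := fun i => gaussianReal (a i) v)
      (f := fun x => (x - b) ^ 2) (integrable_sq_sub_gaussianReal (a i) b)
  have he : ∀ i b, ∫ y : ι → ℝ, (y i - b) ^ 2 ∂(Measure.pi fun i => gaussianReal (a i) v) =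
      v + (a i - b) ^ 2 := fun i b => by
    rw [← integral_sq_sub_gaussianReal]
    exact integral_comp_eval (μ := fun i => gaussianReal (a i) v) (f := fun x => (x - b) ^ 2)
      (by fun_prop)
  have hlog : Real.log (w / v) = Real.log (2 * Real.pi * w) - Real.log (2 * Real.pi * v) := by
    rw [← Real.log_div (by positivity) (by positivity)]
    congr 1
    field_simp
  have hrw : ∀ y : ι → ℝ, Real.log (gaussDensity v a y) - Real.log (gaussDensity w 0 y) =
      ∑ i, (1 / 2 * Real.log (w / v) + ((y i - 0) ^ 2 / (2 * w) - (y i - a i) ^ 2 / (2 * v))) := by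
    intro y
    rw [log_gaussDensity hv, log_gaussDensity hw, ← Finset.sum_sub_distrib]
    refine Finset.sum_congr rfl fun i _ => ?_
    rw [hlog]
    simp only [Pi.zero_apply]
    ring
  simp_rw [hrw]
  rw [integral_finsetSum _ fun i _ => ?_]
  · have : ∀ i, ∫ y : ι → ℝ, (1 / 2 * Real.log (w / v) + ((y i - 0) ^ 2 / (2 * w) -
        (y i - a i) ^ 2 / (2 * v))) ∂(Measure.pi fun i => gaussianReal (a i) v) =
        1 / 2 * Real.log (w / v) + (a i ^ 2 - (w - v)) / (2 * w) := by
      intro i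
      have hs : Integrable (fun y : ι → ℝ => (y i - 0) ^ 2 / (2 * w) - (y i - a i) ^ 2 / (2 * v))
          (Measure.pi fun i => gaussianReal (a i) v) :=
        ((hi i 0).div_const _).sub ((hi i _).div_const _)
      rw [integral_add (integrable_const _) hs,
        integral_sub ((hi i 0).div_const _) ((hi i _).div_const _), integral_div, integral_div,
        he, he]
      simp only [integral_const, probReal_univ, smul_eq_mul, one_mul]
      field_simp
      ring
    simp_rw [this]
    rw [Finset.sum_add_distrib, ← Finset.sum_div, Finset.sum_sub_distrib]
    simp
    ring
  · exact (integrable_const _).add (((hi i 0).div_const _).sub ((hi i _).div_const _))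

end Density

/-! ### Gaussian mixtures, posterior means and the entropy bound. -/

section Mixture

variable {S ι : Type*} [Fintype S] [Fintype ι] {v w : ℝ≥0}

/-- The mixture with weights `p` of the Gaussian densities centred at the points `a s`. -/
noncomputable def mixDensity (v : ℝ≥0) (p : S → ℝ) (a : S → ι → ℝ) (y : ι → ℝ) : ℝ :=
  ∑ s, p s * gaussDensity v (a s) y

/-- The mean of `φ` under the posterior distribution of `s` given the channel output `y`. -/
noncomputable def posteriorMean (v : ℝ≥0) (p : S → ℝ) (a : S → ι → ℝ) (φ : S → ℝ)
    (y : ι → ℝ) : ℝ :=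
  (∑ s, p s * gaussDensity v (a s) y * φ s) / mixDensity v p a y

lemma mixDensity_pos (hv : v ≠ 0) {p : S → ℝ} (hp : ∀ s, 0 ≤ p s) (hp1 : ∑ s, p s = 1)
    (a : S → ι → ℝ) (y : ι → ℝ) : 0 < mixDensity v p a y := by
  obtain ⟨s, hs⟩ : ∃ s, 0 < p s := by
    by_contra! h
    have : ∑ s, p s ≤ 0 := Finset.sum_nonpos fun s _ => h s
    linarith
  exact Finset.sum_pos' (fun s _ => mul_nonneg (hp s) (gaussDensity_pos hv _ _).le)
    ⟨s, Finset.mem_univ s, mul_pos hs (gaussDensity_pos hv _ _)⟩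

lemma integrable_mixDensity (v : ℝ≥0) (p : S → ℝ) (a : S → ι → ℝ) :
    Integrable (mixDensity v p a) :=
  integrable_finsetSum _ fun s _ => (integrable_gaussDensity v (a s)).const_mul (p s)

lemma integral_mixDensity (hv : v ≠ 0) {p : S → ℝ} (hp1 : ∑ s, p s = 1) (a : S → ι → ℝ) :
    ∫ y, mixDensity v p a y = 1 := by
  unfold mixDensity
  rw [integral_finsetSum _ fun s _ => (integrable_gaussDensity v (a s)).const_mul (p s)]
  simp [integral_const_mul, integral_gaussDensity hv, hp1]

lemma measurable_mixDensity (v : ℝ≥0) (p : S → ℝ) (a : S → ι → ℝ) :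
    Measurable (mixDensity v p a) :=
  Finset.measurable_sum _ fun s _ => (measurable_gaussDensity v (a s)).const_mul (p s)

lemma measurable_posteriorMean (v : ℝ≥0) (p : S → ℝ) (a : S → ι → ℝ) (φ : S → ℝ) :
    Measurable (posteriorMean v p a φ) :=
  (Finset.measurable_sum _ fun s _ =>
    ((measurable_gaussDensity v (a s)).const_mul (p s)).mul_const (φ s)).div
    (measurable_mixDensity v p a)

lemma mixDensity_mul_posteriorMean (hv : v ≠ 0) {p : S → ℝ} (hp : ∀ s, 0 ≤ p s)
    (hp1 : ∑ s, p s = 1) (a : S → ι → ℝ) (φ : S → ℝ) (y : ι → ℝ) :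
    mixDensity v p a y * posteriorMean v p a φ y = ∑ s, p s * gaussDensity v (a s) y * φ s :=
  mul_div_cancel₀ _ (mixDensity_pos hv hp hp1 a y).ne'

lemma abs_posteriorMean_le (hv : v ≠ 0) {p : S → ℝ} (hp : ∀ s, 0 ≤ p s) (hp1 : ∑ s, p s = 1)
    (a : S → ι → ℝ) {φ : S → ℝ} {M : ℝ} (hφ : ∀ s, |φ s| ≤ M) (y : ι → ℝ) :
    |posteriorMean v p a φ y| ≤ M := by
  have hq := mixDensity_pos hv hp hp1 a y
  rw [posteriorMean, abs_div, abs_of_pos hq, div_le_iff₀ hq, mixDensity, Finset.mul_sum]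
  refine (Finset.abs_sum_le_sum_abs _ _).trans (Finset.sum_le_sum fun s _ => ?_)
  have h0 : 0 ≤ p s * gaussDensity v (a s) y := mul_nonneg (hp s) (gaussDensity_pos hv _ _).le
  rw [abs_mul, abs_of_nonneg h0, mul_comm M]
  exact mul_le_mul_of_nonneg_left (hφ s) h0

lemma integrable_mixDensity_mul_sq_posteriorMean (hv : v ≠ 0) {p : S → ℝ} (hp : ∀ s, 0 ≤ p s)
    (hp1 : ∑ s, p s = 1) (a : S → ι → ℝ) {φ : S → ℝ} {M : ℝ} (hφ : ∀ s, |φ s| ≤ M) :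
    Integrable fun y => mixDensity v p a y * posteriorMean v p a φ y ^ 2 := by
  refine ((integrable_mixDensity v p a).mul_const (M ^ 2)).mono'
    ((measurable_mixDensity v p a).mul
      ((measurable_posteriorMean v p a φ).pow_const 2)).aestronglyMeasurable
    (Filter.Eventually.of_forall fun y => ?_)
  have hq := mixDensity_pos hv hp hp1 a y
  rw [Real.norm_eq_abs, abs_of_nonneg (by positivity)]
  exact mul_le_mul_of_nonneg_left
    (sq_le_sq' (abs_le.1 (abs_posteriorMean_le hv hp hp1 a hφ y)).1
      (abs_le.1 (abs_posteriorMean_le hv hp hp1 a hφ y)).2) hq.le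

lemma integral_mixDensity_mul_sq_posteriorMean_le (hv : v ≠ 0) {p : S → ℝ} (hp : ∀ s, 0 ≤ p s)
    (hp1 : ∑ s, p s = 1) (a : S → ι → ℝ) {φ : S → ℝ} {M : ℝ} (hφ : ∀ s, |φ s| ≤ M) :
    ∫ y, mixDensity v p a y * posteriorMean v p a φ y ^ 2 ≤ M ^ 2 := by
  calc ∫ y, mixDensity v p a y * posteriorMean v p a φ y ^ 2
      ≤ ∫ y, mixDensity v p a y * M ^ 2 := by
        refine integral_mono (integrable_mixDensity_mul_sq_posteriorMean hv hp hp1 a hφ)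
          ((integrable_mixDensity v p a).mul_const _) fun y => ?_
        exact mul_le_mul_of_nonneg_left
          (sq_le_sq' (abs_le.1 (abs_posteriorMean_le hv hp hp1 a hφ y)).1
            (abs_le.1 (abs_posteriorMean_le hv hp hp1 a hφ y)).2)
          (mixDensity_pos hv hp hp1 a y).le
    _ = M ^ 2 := by rw [integral_mul_const, integral_mixDensity hv hp1, one_mul]

/-- The Fenchel inequality for the relative entropy integrand. -/
lemma mul_add_one_sub_mul_exp_le {x r : ℝ} (hx : 0 < x) (hr : 0 < r) (h : ℝ) :
    x * (h + 1) - r * Real.exp h ≤ x * (Real.log x - Real.log r) := by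
  have h1 := Real.add_one_le_exp (h - (Real.log x - Real.log r))
  have h2 : x * Real.exp (h - (Real.log x - Real.log r)) = r * Real.exp h := by
    rw [Real.exp_sub, Real.exp_sub, Real.exp_log hx, Real.exp_log hr]
    field_simp
  nlinarith [mul_le_mul_of_nonneg_left h1 hx.le]

/-- Subgaussian statistics of the channel input have posterior means whose total second moment
is bounded by the information that the Gaussian channel can convey. -/
lemma integral_sum_sq_posteriorMean_le {κ : Type*} [Fintype κ] (hv : v ≠ 0) (hw : w ≠ 0)
    {p : S → ℝ} (hp : ∀ s, 0 ≤ p s) (hp1 : ∑ s, p s = 1) (a : S → ι → ℝ)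
    (φ : κ → S → ℝ) {M : ℝ} (hφ : ∀ j s, |φ j s| ≤ M) {K : ℝ} (hK : 0 < K)
    (hsub : ∀ θ : κ → ℝ, ∑ s, p s * Real.exp (∑ j, θ j * φ j s) ≤
      Real.exp (K / 2 * ∑ j, θ j ^ 2)) :
    ∑ j, ∫ y, mixDensity v p a y * posteriorMean v p a (φ j) y ^ 2 ≤
      2 * K * (Fintype.card ι / 2 * Real.log (w / v) +
        (∑ s, p s * ∑ i, a s i ^ 2 - Fintype.card ι * (w - v)) / (2 * w)) := by
  set m : κ → (ι → ℝ) → ℝ := fun j => posteriorMean v p a (φ j) with hm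
  have hmi : ∀ j, Integrable fun y => mixDensity v p a y * m j y ^ 2 := fun j =>
    integrable_mixDensity_mul_sq_posteriorMean hv hp hp1 a (hφ j)
  -- The bound holds pointwise in `y` up to a difference of two probability densities, which
  -- integrates to zero.
  have hpt : ∀ y, 1 / (2 * K) * ∑ j, mixDensity v p a y * m j y ^ 2 +
      (mixDensity v p a y - gaussDensity w 0 y) ≤
      ∑ s, p s * (gaussDensity v (a s) y *
        (Real.log (gaussDensity v (a s) y) - Real.log (gaussDensity w 0 y))) := by
    intro y
    set n : ℝ := ∑ j, m j y ^ 2 with hn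
    -- Test function for the Fenchel inequality: `θ = m / K` maximizes `⟨θ, m⟩ - K/2 ‖θ‖²`, and
    -- subtracting the maximum `n / (2 * K)` makes the exponential moment at most 1.
    set h : S → ℝ := fun s => ∑ j, (1 / K * m j y) * φ j s - n / (2 * K) with hh
    have hr := gaussDensity_pos hw (0 : ι → ℝ) y
    have hstep : ∑ s, p s * (gaussDensity v (a s) y * (h s + 1) -
        gaussDensity w 0 y * Real.exp (h s)) ≤
        ∑ s, p s * (gaussDensity v (a s) y *
        (Real.log (gaussDensity v (a s) y) - Real.log (gaussDensity w 0 y))) :=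
      Finset.sum_le_sum fun s _ => mul_le_mul_of_nonneg_left
        (mul_add_one_sub_mul_exp_le (gaussDensity_pos hv _ _) hr (h s)) (hp s)
    refine le_trans ?_ hstep
    have hexp : ∑ s, p s * Real.exp (h s) ≤ 1 := by
      have h1 := hsub fun j => 1 / K * m j y
      have h2 : K / 2 * ∑ j, (1 / K * m j y) ^ 2 = n / (2 * K) := by
        simp_rw [mul_pow, ← Finset.mul_sum]
        rw [← hn]
        field_simp
      rw [h2] at h1
      have h3 : ∀ s, p s * Real.exp (h s) =
          p s * Real.exp (∑ j, (1 / K * m j y) * φ j s) * Real.exp (-(n / (2 * K))) := by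
        intro s
        rw [mul_assoc, ← Real.exp_add, ← sub_eq_add_neg]
      simp_rw [h3, ← Finset.sum_mul]
      calc _ ≤ Real.exp (n / (2 * K)) * Real.exp (-(n / (2 * K))) :=
            mul_le_mul_of_nonneg_right h1 (Real.exp_pos _).le
        _ = 1 := by rw [← Real.exp_add]; simp
    have hlin : ∑ s, p s * gaussDensity v (a s) y * h s =
        1 / (2 * K) * (mixDensity v p a y * n) := by
      have h1 : ∑ s, p s * gaussDensity v (a s) y * ∑ j, (1 / K * m j y) * φ j s =
          1 / K * (mixDensity v p a y * n) := by
        simp_rw [Finset.mul_sum]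
        rw [Finset.sum_comm]
        rw [hn, Finset.mul_sum, Finset.mul_sum]
        refine Finset.sum_congr rfl fun j _ => ?_
        calc ∑ s, p s * gaussDensity v (a s) y * (1 / K * m j y * φ j s)
            = 1 / K * m j y * ∑ s, p s * gaussDensity v (a s) y * φ j s := by
              rw [Finset.mul_sum]; exact Finset.sum_congr rfl fun s _ => by ring
          _ = _ := by
              rw [← mixDensity_mul_posteriorMean hv hp hp1 a (φ j) y]; ring
      simp_rw [hh, mul_sub]
      rw [Finset.sum_sub_distrib, h1, ← Finset.sum_mul]
      change 1 / K * (mixDensity v p a y * n) - mixDensity v p a y * _ = _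
      field_simp
      ring
    have hsplit : ∑ s, p s * (gaussDensity v (a s) y * (h s + 1) -
        gaussDensity w 0 y * Real.exp (h s)) =
        ∑ s, p s * gaussDensity v (a s) y * h s + mixDensity v p a y -
          gaussDensity w 0 y * ∑ s, p s * Real.exp (h s) := by
      rw [mixDensity, Finset.mul_sum, ← Finset.sum_add_distrib, ← Finset.sum_sub_distrib]
      exact Finset.sum_congr rfl fun s _ => by ring
    rw [hsplit, hlin, ← Finset.mul_sum, ← hn]
    nlinarith [mul_le_mul_of_nonneg_left hexp hr.le]
  have hq := integrable_mixDensity v p a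
  have hr := integrable_gaussDensity w (0 : ι → ℝ)
  have hL : Integrable fun y => 1 / (2 * K) * ∑ j, mixDensity v p a y * m j y ^ 2 :=
    (integrable_finsetSum _ fun j _ => hmi j).const_mul _
  have hqr : Integrable fun y => mixDensity v p a y - gaussDensity w 0 y := hq.sub hr
  have hR : ∀ s, Integrable fun y => p s * (gaussDensity v (a s) y *
      (Real.log (gaussDensity v (a s) y) - Real.log (gaussDensity w 0 y))) := fun s =>
    (integrable_gaussDensity_mul_log_ratio hv hw (a s)).const_mul (p s)
  have hI := integral_mono (hL.add hqr) (integrable_finsetSum _ fun s _ => hR s) hpt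
  simp only [Pi.add_apply] at hI
  rw [integral_add hL hqr, integral_const_mul, integral_finsetSum _ fun j _ => hmi j,
    integral_sub hq hr, integral_mixDensity hv hp1, integral_gaussDensity hw,
    integral_finsetSum _ fun s _ => hR s] at hI
  simp_rw [integral_const_mul, integral_gaussDensity_mul_log_ratio hv hw, mul_add] at hI
  rw [Finset.sum_add_distrib, ← Finset.sum_mul, hp1] at hI
  have hsum : ∑ s, p s * ((∑ i, a s i ^ 2 - Fintype.card ι * (w - v)) / (2 * w)) =
      (∑ s, p s * ∑ i, a s i ^ 2 - Fintype.card ι * (w - v)) / (2 * w) := by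
    rw [show (∑ s, p s * ∑ i, a s i ^ 2 - (Fintype.card ι : ℝ) * (w - v)) =
      ∑ s, (p s * ∑ i, a s i ^ 2 - p s * (Fintype.card ι * (w - v))) by
        rw [Finset.sum_sub_distrib, ← Finset.sum_mul, hp1, one_mul], Finset.sum_div]
    exact Finset.sum_congr rfl fun s _ => by ring
  rw [hsum] at hI
  have h2K : 0 < 2 * K := by positivity
  rw [one_mul, sub_self, add_zero, one_div, inv_mul_le_iff₀ h2K] at hI
  exact hI

end Mixture

/-! ### Hellinger distance and total variation of product densities. -/

section Hellinger

/-- Pointwise form of the domination of squared Hellinger distance by chi-square, from `(√x + √y)² ≥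
x`. -/
lemma sq_sqrt_sub_sqrt_le {x y : ℝ} (hx : 0 < x) (hy : 0 ≤ y) :
    (√x - √y) ^ 2 ≤ (y - x) ^ 2 / x := by
  rw [le_div_iff₀ hx]
  have h1 := Real.sq_sqrt hx.le
  have h2 := Real.sq_sqrt hy
  have h3 : y - x = -(√x - √y) * (√x + √y) := by nlinarith
  have h4 : x ≤ (√x + √y) ^ 2 := by
    nlinarith [mul_nonneg (Real.sqrt_nonneg x) (Real.sqrt_nonneg y), sq_nonneg √y]
  rw [h3, mul_pow, neg_sq]
  exact mul_le_mul_of_nonneg_left h4 (sq_nonneg _)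

lemma one_sub_prod_le_sum {κ : Type*} (s : Finset κ) (ρ : κ → ℝ) (h0 : ∀ t, 0 ≤ ρ t)
    (h1 : ∀ t, ρ t ≤ 1) : 1 - ∏ t ∈ s, ρ t ≤ ∑ t ∈ s, (1 - ρ t) := by
  classical
  induction s using Finset.induction_on with
  | empty => simp
  | insert a s ha ih =>
    rw [Finset.prod_insert ha, Finset.sum_insert ha]
    have hp1 : ∏ t ∈ s, ρ t ≤ 1 := Finset.prod_le_one (fun t _ => h0 t) fun t _ => h1 t
    have hp0 : 0 ≤ ∏ t ∈ s, ρ t := Finset.prod_nonneg fun t _ => h0 t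
    nlinarith [h0 a, h1 a]

variable {E : Type*} [MeasureSpace E]

lemma integrable_sqrt_mul {q q' : E → ℝ} (hq : Integrable q) (hq' : Integrable q')
    (h0 : ∀ y, 0 ≤ q y) (h0' : ∀ y, 0 ≤ q' y) : Integrable fun y => √(q y) * √(q' y) := by
  refine (hq.add hq').mono'
    (hq.1.aemeasurable.sqrt.mul hq'.1.aemeasurable.sqrt).aestronglyMeasurable
    (Filter.Eventually.of_forall fun y => ?_)
  have h1 := Real.sq_sqrt (h0 y)
  have h2 := Real.sq_sqrt (h0' y)
  rw [Real.norm_eq_abs, abs_of_nonneg (by positivity), Pi.add_apply]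
  nlinarith [sq_nonneg (√(q y) - √(q' y)), sq_nonneg (√(q y) + √(q' y))]

lemma integral_sq_sqrt_sub_sqrt {q q' : E → ℝ} (hq : Integrable q) (hq' : Integrable q')
    (h0 : ∀ y, 0 ≤ q y) (h0' : ∀ y, 0 ≤ q' y) (h1 : ∫ y, q y = 1) (h1' : ∫ y, q' y = 1) :
    ∫ y, (√(q y) - √(q' y)) ^ 2 = 2 - 2 * ∫ y, √(q y) * √(q' y) := by
  have hrw : ∀ y, (√(q y) - √(q' y)) ^ 2 = (q y + q' y) - 2 * (√(q y) * √(q' y)) := fun y => by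
    nlinarith [Real.sq_sqrt (h0 y), Real.sq_sqrt (h0' y)]
  have hs : Integrable fun y => q y + q' y := hq.add hq'
  simp_rw [hrw]
  rw [integral_sub hs ((integrable_sqrt_mul hq hq' h0 h0').const_mul 2), integral_add hq hq',
    h1, h1', integral_const_mul]
  ring

/-- The total variation of two product densities through the Hellinger distances of the factors. -/
lemma integral_abs_prod_sub_prod_le {κ : Type*} [Fintype κ] [SigmaFinite (volume : Measure E)]
    {q q' : κ → E → ℝ}
    (hq : ∀ t, Integrable (q t)) (hq' : ∀ t, Integrable (q' t)) (h0 : ∀ t y, 0 ≤ q t y)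
    (h0' : ∀ t y, 0 ≤ q' t y) (h1 : ∀ t, ∫ y, q t y = 1) (h1' : ∀ t, ∫ y, q' t y = 1) :
    ∫ y : κ → E, |∏ t, q t (y t) - ∏ t, q' t (y t)| ≤
      1 + ∑ t, ∫ y, (√(q t y) - √(q' t y)) ^ 2 := by
  have hQ : Integrable fun y : κ → E => ∏ t, q t (y t) := Integrable.fintype_prod hq
  have hQ' : Integrable fun y : κ → E => ∏ t, q' t (y t) := Integrable.fintype_prod hq'
  have hQ0 : ∀ y : κ → E, 0 ≤ ∏ t, q t (y t) := fun y => Finset.prod_nonneg fun t _ => h0 t _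
  have hQ0' : ∀ y : κ → E, 0 ≤ ∏ t, q' t (y t) := fun y => Finset.prod_nonneg fun t _ => h0' t _
  have hQ1 : ∫ y : κ → E, ∏ t, q t (y t) = 1 := by
    rw [integral_fintype_prod_volume_eq_prod]; simp [h1]
  have hQ1' : ∫ y : κ → E, ∏ t, q' t (y t) = 1 := by
    rw [integral_fintype_prod_volume_eq_prod]; simp [h1']
  set ρ : κ → ℝ := fun t => ∫ y, √(q t y) * √(q' t y) with hρ
  have hH : ∀ t, ∫ y, (√(q t y) - √(q' t y)) ^ 2 = 2 - 2 * ρ t := fun t =>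
    integral_sq_sqrt_sub_sqrt (hq t) (hq' t) (h0 t) (h0' t) (h1 t) (h1' t)
  have hρ1 : ∀ t, ρ t ≤ 1 := fun t => by
    have : 0 ≤ ∫ y, (√(q t y) - √(q' t y)) ^ 2 := integral_nonneg fun y => sq_nonneg _
    rw [hH] at this
    linarith
  have hρ0 : ∀ t, 0 ≤ ρ t := fun t =>
    integral_nonneg fun y => mul_nonneg (Real.sqrt_nonneg _) (Real.sqrt_nonneg _)
  have hprod : ∫ y : κ → E, √(∏ t, q t (y t)) * √(∏ t, q' t (y t)) = ∏ t, ρ t := by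
    rw [hρ, ← integral_fintype_prod_volume_eq_prod fun t y => √(q t y) * √(q' t y)]
    refine integral_congr_ae (Filter.Eventually.of_forall fun y => ?_)
    simp only
    rw [Real.sqrt_prod _ fun t _ => h0 t _, Real.sqrt_prod _ fun t _ => h0' t _,
      Finset.prod_mul_distrib]
  have hG := integrable_sqrt_mul hQ hQ' hQ0 hQ0'
  -- The right side is `(α - β)² + (α + β)² / 4` in the square roots `α`, `β` of the densities. It
  -- integrates to `5/2 - 3/2 ∏ ρ = 1 + 3/2 (1 - ∏ ρ)`; the leading 1 is half of the trivial bound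
  -- 2, and this gap leaves room for the argument.
  have hb : ∀ y : κ → E, |∏ t, q t (y t) - ∏ t, q' t (y t)| ≤
      5 / 4 * (∏ t, q t (y t)) + (5 / 4 * (∏ t, q' t (y t)) -
        3 / 2 * (√(∏ t, q t (y t)) * √(∏ t, q' t (y t)))) := by
    intro y
    have e1 := Real.sq_sqrt (hQ0 y)
    have e2 := Real.sq_sqrt (hQ0' y)
    set α := √(∏ t, q t (y t))
    set β := √(∏ t, q' t (y t))
    rw [← e1, ← e2, abs_le]
    constructor <;> nlinarith [sq_nonneg ((α - β) + (α + β) / 2), sq_nonneg ((α - β) - (α + β) / 2)]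
  have hi : Integrable fun y : κ → E => 5 / 4 * (∏ t, q' t (y t)) -
        3 / 2 * (√(∏ t, q t (y t)) * √(∏ t, q' t (y t))) := (hQ'.const_mul _).sub (hG.const_mul _)
  have hfin := integral_mono (hQ.sub hQ').abs ((hQ.const_mul (5 / 4)).add hi) hb
  simp only [Pi.add_apply, Pi.sub_apply] at hfin
  rw [integral_add (hQ.const_mul _) hi, integral_sub (hQ'.const_mul _) (hG.const_mul _),
    integral_const_mul, integral_const_mul, integral_const_mul, hQ1, hQ1', hprod] at hfin
  have hp := one_sub_prod_le_sum Finset.univ ρ hρ0 hρ1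
  have hp1 : ∏ t, ρ t ≤ 1 := Finset.prod_le_one (fun t _ => hρ0 t) fun t _ => hρ1 t
  have hs : ∑ t, ∫ y, (√(q t y) - √(q' t y)) ^ 2 = 2 * ∑ t, (1 - ρ t) := by
    rw [Finset.mul_sum]
    exact Finset.sum_congr rfl fun t _ => by rw [hH]; ring
  rw [hs]
  linarith

end Hellinger

/-! ### Biased sign vectors and the information the channel conveys about them. -/

section Hypercube

/-- The sign `±1` of a Boolean. -/
def boolSign (b : Bool) : ℝ := if b then 1 else -1

/-- The probability of the sign `c` under the distribution on signs with mean `δ * boolSign b`. -/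
noncomputable def signWeight (δ : ℝ) (b c : Bool) : ℝ := (1 + δ * (boolSign b * boolSign c)) / 2

/-- The normalized change of the likelihood of `c` when the bias `b` is flipped. -/
noncomputable def signScore (δ : ℝ) (b c : Bool) : ℝ :=
  2 * (boolSign b * boolSign c) / (1 + δ * (boolSign b * boolSign c))

/-- The product distribution on sign vectors with mean `δ` times the sign vector `v`. -/
noncomputable def cubeWeight {d : ℕ} (δ : ℝ) (v s : Fin d → Bool) : ℝ :=
  ∏ i, signWeight δ (v i) (s i)

/-- The sign vector with the `i`-th sign flipped. -/
def flipAt {d : ℕ} (i : Fin d) (v : Fin d → Bool) : Fin d → Bool := Function.update v i (!v i)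

lemma boolSign_mul_eq (b c : Bool) : boolSign b * boolSign c = 1 ∨ boolSign b * boolSign c = -1 := by
  cases b <;> cases c <;> simp [boolSign]

lemma abs_boolSign (b : Bool) : |boolSign b| = 1 := by cases b <;> simp [boolSign]

lemma boolSign_not (b : Bool) : boolSign (!b) = -boolSign b := by cases b <;> simp [boolSign]

lemma flipAt_involutive {d : ℕ} (i : Fin d) : Function.Involutive (flipAt i) := by
  intro v
  simp [flipAt]

variable {d : ℕ} {δ : ℝ}

lemma signWeight_nonneg (h0 : 0 ≤ δ) (h1 : δ ≤ 1 / 2) (b c : Bool) : 0 ≤ signWeight δ b c := by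
  unfold signWeight
  rcases boolSign_mul_eq b c with h | h <;> rw [h] <;> linarith

lemma signWeight_add (δ : ℝ) (b : Bool) : signWeight δ b true + signWeight δ b false = 1 := by
  cases b <;> simp [signWeight, boolSign] <;> ring

lemma abs_signScore_le (h0 : 0 ≤ δ) (h1 : δ ≤ 1 / 2) (b c : Bool) : |signScore δ b c| ≤ 4 := by
  unfold signScore
  rcases boolSign_mul_eq b c with h | h <;> rw [h, abs_le] <;> constructor
  · rw [le_div_iff₀ (by linarith)]; linarith
  · rw [div_le_iff₀ (by linarith)]; linarith
  · rw [le_div_iff₀ (by linarith)]; linarith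
  · rw [div_le_iff₀ (by linarith)]; linarith

lemma signWeight_mul_signScore (h0 : 0 ≤ δ) (h1 : δ ≤ 1 / 2) (b c : Bool) :
    signWeight δ b c * signScore δ b c = boolSign b * boolSign c := by
  unfold signWeight signScore
  have : 1 + δ * (boolSign b * boolSign c) ≠ 0 := by
    rcases boolSign_mul_eq b c with h | h <;> rw [h] <;> intro h <;> linarith
  rw [div_mul_div_comm, div_eq_iff (mul_ne_zero two_ne_zero this)]
  ring

/-- The flip is exactly linear in the score, with no remainder, and the score is bounded uniformly
in `δ`. -/
lemma signWeight_not (h0 : 0 ≤ δ) (h1 : δ ≤ 1 / 2) (b c : Bool) :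
    signWeight δ (!b) c = signWeight δ b c - δ * (signWeight δ b c * signScore δ b c) := by
  rw [signWeight_mul_signScore h0 h1, signWeight, signWeight, boolSign_not]
  ring

/-- For a centred variable the linear term disappears on averaging, which turns boundedness into
subgaussianity. -/
lemma exp_le_add_exp_sq (x : ℝ) : Real.exp x ≤ x + Real.exp (x ^ 2) := by
  have h2 := Real.add_one_le_exp (x ^ 2)
  rcases le_or_gt |x| 1 with h | h
  · have := (abs_le.1 (Real.abs_exp_sub_one_sub_id_le h)).2
    linarith
  · rcases lt_abs.1 h with h | h
    · have : Real.exp x ≤ Real.exp (x ^ 2) := Real.exp_le_exp.2 (by nlinarith)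
      linarith
    · have : Real.exp x ≤ 1 := Real.exp_le_one_iff.2 (by linarith)
      nlinarith

lemma signScore_subgaussian (h0 : 0 ≤ δ) (h1 : δ ≤ 1 / 2) (b : Bool) (θ : ℝ) :
    ∑ c, signWeight δ b c * Real.exp (θ * signScore δ b c) ≤ Real.exp (16 * θ ^ 2) := by
  have hb : ∀ c, Real.exp (θ * signScore δ b c) ≤
      θ * signScore δ b c + Real.exp (16 * θ ^ 2) := by
    intro c
    refine (exp_le_add_exp_sq _).trans (add_le_add_right (Real.exp_le_exp.2 ?_) _)
    have h := abs_le.1 (abs_signScore_le h0 h1 b c)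
    nlinarith [sq_nonneg θ, mul_le_mul_of_nonneg_left
      (show signScore δ b c ^ 2 ≤ 16 by nlinarith) (sq_nonneg θ)]
  calc ∑ c, signWeight δ b c * Real.exp (θ * signScore δ b c)
      ≤ ∑ c, signWeight δ b c * (θ * signScore δ b c + Real.exp (16 * θ ^ 2)) :=
        Finset.sum_le_sum fun c _ => mul_le_mul_of_nonneg_left (hb c) (signWeight_nonneg h0 h1 b c)
    _ = θ * ∑ c, signWeight δ b c * signScore δ b c +
          (∑ c, signWeight δ b c) * Real.exp (16 * θ ^ 2) := by
        rw [Finset.mul_sum, Finset.sum_mul, ← Finset.sum_add_distrib]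
        exact Finset.sum_congr rfl fun c _ => by ring
    _ = Real.exp (16 * θ ^ 2) := by
        simp_rw [signWeight_mul_signScore h0 h1]
        rw [Fintype.sum_bool, Fintype.sum_bool, signWeight_add]
        simp [boolSign]

lemma cubeWeight_nonneg (h0 : 0 ≤ δ) (h1 : δ ≤ 1 / 2) (v s : Fin d → Bool) :
    0 ≤ cubeWeight δ v s :=
  Finset.prod_nonneg fun _ _ => signWeight_nonneg h0 h1 _ _

lemma sum_cubeWeight (δ : ℝ) (v : Fin d → Bool) : ∑ s, cubeWeight δ v s = 1 := by
  unfold cubeWeight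
  rw [← Fintype.prod_sum fun i c => signWeight δ (v i) c]
  simp [signWeight_add]

lemma sum_cubeWeight_mul_boolSign (δ : ℝ) (v : Fin d → Bool) (i : Fin d) :
    ∑ s, cubeWeight δ v s * boolSign (s i) = δ * boolSign (v i) := by
  have h : ∀ s : Fin d → Bool, cubeWeight δ v s * boolSign (s i) =
      ∏ j, signWeight δ (v j) (s j) * (if j = i then boolSign (s j) else 1) := by
    intro s
    rw [Finset.prod_mul_distrib, Finset.prod_ite_eq' Finset.univ i]
    simp [cubeWeight]
  simp_rw [h]
  rw [← Fintype.prod_sum fun j c => signWeight δ (v j) c * (if j = i then boolSign c else 1),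
    Finset.prod_eq_single i]
  · simp only [if_true, Fintype.sum_bool]
    cases v i <;> simp [signWeight, boolSign] <;> ring
  · intro j _ hj
    simp [hj, signWeight_add]
  · simp

lemma cubeWeight_flipAt (h0 : 0 ≤ δ) (h1 : δ ≤ 1 / 2) (v s : Fin d → Bool) (i : Fin d) :
    cubeWeight δ (flipAt i v) s =
      cubeWeight δ v s - δ * (cubeWeight δ v s * signScore δ (v i) (s i)) := by
  unfold cubeWeight
  rw [← Finset.mul_prod_erase Finset.univ _ (Finset.mem_univ i),
    ← Finset.mul_prod_erase Finset.univ (fun j => signWeight δ (v j) (s j)) (Finset.mem_univ i)]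
  have : ∏ j ∈ Finset.univ.erase i, signWeight δ (flipAt i v j) (s j) =
      ∏ j ∈ Finset.univ.erase i, signWeight δ (v j) (s j) := by
    refine Finset.prod_congr rfl fun j hj => ?_
    rw [flipAt, Function.update_of_ne (Finset.ne_of_mem_erase hj)]
  rw [this, flipAt, Function.update_self, signWeight_not h0 h1]
  ring

/-- Coordinates are independent, so exponential moments multiply. The constant is `K = 32`, since `K
/ 2 = 4²`. -/
lemma cubeWeight_subgaussian (h0 : 0 ≤ δ) (h1 : δ ≤ 1 / 2) (v : Fin d → Bool) (θ : Fin d → ℝ) :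
    ∑ s, cubeWeight δ v s * Real.exp (∑ j, θ j * signScore δ (v j) (s j)) ≤
      Real.exp (32 / 2 * ∑ j, θ j ^ 2) := by
  have h : ∀ s : Fin d → Bool,
      cubeWeight δ v s * Real.exp (∑ j, θ j * signScore δ (v j) (s j)) =
      ∏ j, signWeight δ (v j) (s j) * Real.exp (θ j * signScore δ (v j) (s j)) := by
    intro s
    rw [Real.exp_sum, Finset.prod_mul_distrib, cubeWeight]
  simp_rw [h]
  rw [← Fintype.prod_sum fun j c => signWeight δ (v j) c * Real.exp (θ j * signScore δ (v j) c),
    Finset.mul_sum, Real.exp_sum]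
  refine Finset.prod_le_prod (fun j _ => Finset.sum_nonneg fun c _ =>
    mul_nonneg (signWeight_nonneg h0 h1 _ _) (Real.exp_pos _).le) fun j _ => ?_
  exact (signScore_subgaussian h0 h1 (v j) (θ j)).trans_eq (by norm_num)

variable {ι : Type*} [Fintype ι] {τ : ℝ≥0}

/-- The information about the signs `v` in one channel output, as the total second moment of the
posterior means of the scores. -/
noncomputable def scoreInformation (τ : ℝ≥0) (δ : ℝ) (v : Fin d → Bool)
    (a : (Fin d → Bool) → ι → ℝ) : ℝ :=
  ∑ i, ∫ y, mixDensity τ (cubeWeight δ v) a y *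
    posteriorMean τ (cubeWeight δ v) a (fun s => signScore δ (v i) (s i)) y ^ 2

/-- A posterior mean inherits the bound 4 of the score, however good the channel is. -/
lemma scoreInformation_le_dim (hτ : τ ≠ 0) (h0 : 0 ≤ δ) (h1 : δ ≤ 1 / 2) (v : Fin d → Bool)
    (a : (Fin d → Bool) → ι → ℝ) : scoreInformation τ δ v a ≤ 16 * d := by
  calc scoreInformation τ δ v a ≤ ∑ _i : Fin d, (4 : ℝ) ^ 2 :=
        Finset.sum_le_sum fun i _ => integral_mixDensity_mul_sq_posteriorMean_le hτ
          (cubeWeight_nonneg h0 h1 v) (sum_cubeWeight δ v) a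
          fun s => abs_signScore_le h0 h1 (v i) (s i)
    _ = 16 * d := by simp; ring

/-- The reference variance `w` is free; with `w = τ + P` the first term is the Gaussian capacity and
the second compares the power spent with the budget. -/
lemma scoreInformation_le_capacity (hτ : τ ≠ 0) {w : ℝ≥0} (hw : w ≠ 0) (h0 : 0 ≤ δ)
    (h1 : δ ≤ 1 / 2) (v : Fin d → Bool) (a : (Fin d → Bool) → ι → ℝ) :
    scoreInformation τ δ v a ≤ 2 * 32 * (Fintype.card ι / 2 * Real.log (w / τ) +
      (∑ s, cubeWeight δ v s * ∑ i, a s i ^ 2 - Fintype.card ι * (w - τ)) / (2 * w)) :=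
  integral_sum_sq_posteriorMean_le hτ hw (cubeWeight_nonneg h0 h1 v) (sum_cubeWeight δ v) a
    (fun i s => signScore δ (v i) (s i)) (fun i s => abs_signScore_le h0 h1 (v i) (s i))
    (by norm_num) (cubeWeight_subgaussian h0 h1 v)

lemma mixDensity_flipAt (hτ : τ ≠ 0) (h0 : 0 ≤ δ) (h1 : δ ≤ 1 / 2) (v : Fin d → Bool)
    (a : (Fin d → Bool) → ι → ℝ) (i : Fin d) (y : ι → ℝ) :
    mixDensity τ (cubeWeight δ (flipAt i v)) a y - mixDensity τ (cubeWeight δ v) a y =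
      -(δ * (mixDensity τ (cubeWeight δ v) a y *
        posteriorMean τ (cubeWeight δ v) a (fun s => signScore δ (v i) (s i)) y)) := by
  rw [mixDensity_mul_posteriorMean hτ (cubeWeight_nonneg h0 h1 v) (sum_cubeWeight δ v),
    mixDensity, mixDensity, ← Finset.sum_sub_distrib, Finset.mul_sum, ← Finset.sum_neg_distrib]
  refine Finset.sum_congr rfl fun s _ => ?_
  rw [cubeWeight_flipAt h0 h1]
  ring

/-- By `mixDensity_flipAt` the chi-square integrand is exactly `δ²` times the density times the
squared posterior mean. -/
lemma sum_hellinger_flipAt_le (hτ : τ ≠ 0) (h0 : 0 ≤ δ) (h1 : δ ≤ 1 / 2) (v : Fin d → Bool)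
    (a : (Fin d → Bool) → ι → ℝ) :
    ∑ i, ∫ y, (√(mixDensity τ (cubeWeight δ v) a y) -
      √(mixDensity τ (cubeWeight δ (flipAt i v)) a y)) ^ 2 ≤ δ ^ 2 * scoreInformation τ δ v a := by
  rw [scoreInformation, Finset.mul_sum]
  refine Finset.sum_le_sum fun i _ => ?_
  rw [← integral_const_mul]
  have hpos : ∀ v y, 0 < mixDensity τ (cubeWeight δ v) a y := fun v y =>
    mixDensity_pos hτ (cubeWeight_nonneg h0 h1 v) (sum_cubeWeight δ v) a y
  refine integral_mono_of_nonneg (Filter.Eventually.of_forall fun y => sq_nonneg _)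
    ((integrable_mixDensity_mul_sq_posteriorMean hτ (cubeWeight_nonneg h0 h1 v)
      (sum_cubeWeight δ v) a fun s => abs_signScore_le h0 h1 (v i) (s i)).const_mul _)
    (Filter.Eventually.of_forall fun y => ?_)
  refine (sq_sqrt_sub_sqrt_le (hpos v y) (hpos _ y).le).trans_eq ?_
  rw [mixDensity_flipAt hτ h0 h1]
  have := (hpos v y).ne'
  field_simp

variable {κ : Type*} [Fintype κ]

/-- The joint density of the channel outputs when the signs are `v` and `c t` is the code in use in
iteration `t`. -/
noncomputable def outputDensity (τ : ℝ≥0) (δ : ℝ) (v : Fin d → Bool)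
    (c : κ → (Fin d → Bool) → ι → ℝ) (y : κ → ι → ℝ) : ℝ :=
  ∏ t, mixDensity τ (cubeWeight δ v) (c t) (y t)

lemma integrable_outputDensity (v : Fin d → Bool) (c : κ → (Fin d → Bool) → ι → ℝ) :
    Integrable (outputDensity τ δ v c) :=
  Integrable.fintype_prod fun t => integrable_mixDensity τ (cubeWeight δ v) (c t)

lemma integrable_outputDensity_mul (v : Fin d → Bool) (c : κ → (Fin d → Bool) → ι → ℝ)
    {G : (κ → ι → ℝ) → ℝ} (hG : Measurable G) {r : ℝ} (hr : ∀ y, |G y| ≤ r) :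
    Integrable fun y => outputDensity τ δ v c y * G y :=
  (integrable_outputDensity v c).mul_bdd (c := r) hG.aestronglyMeasurable
    (Filter.Eventually.of_forall hr)

/-- No estimator `G` of the signs correlates much better with them under `v` than under the sign
vectors that differ from `v` in one place. -/
lemma sum_boolSign_mul_integral_sub_le (hτ : τ ≠ 0) (h0 : 0 ≤ δ) (h1 : δ ≤ 1 / 2)
    (v : Fin d → Bool) (c : κ → (Fin d → Bool) → ι → ℝ) (G : Fin d → (κ → ι → ℝ) → ℝ)
    (hG : ∀ i, Measurable (G i)) {r : ℝ} (hr0 : 0 ≤ r) (hr : ∀ i y, |G i y| ≤ r) :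
    ∑ i, boolSign (v i) * ((∫ y, outputDensity τ δ v c y * G i y) -
        ∫ y, outputDensity τ δ (flipAt i v) c y * G i y) ≤
      r * (d + δ ^ 2 * ∑ t, scoreInformation τ δ v (c t)) := by
  have hpos : ∀ v t y, 0 ≤ mixDensity τ (cubeWeight δ v) (c t) y := fun v t y =>
    (mixDensity_pos hτ (cubeWeight_nonneg h0 h1 v) (sum_cubeWeight δ v) (c t) y).le
  have hterm : ∀ i, boolSign (v i) * ((∫ y, outputDensity τ δ v c y * G i y) -
        ∫ y, outputDensity τ δ (flipAt i v) c y * G i y) ≤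
      r * (1 + ∑ t, ∫ y, (√(mixDensity τ (cubeWeight δ v) (c t) y) -
        √(mixDensity τ (cubeWeight δ (flipAt i v)) (c t) y)) ^ 2) := by
    intro i
    rw [← integral_sub (integrable_outputDensity_mul v c (hG i) (hr i))
      (integrable_outputDensity_mul _ c (hG i) (hr i))]
    refine (le_abs_self _).trans ?_
    rw [abs_mul, abs_boolSign, one_mul]
    refine (abs_integral_le_integral_abs).trans ?_
    calc ∫ y, |outputDensity τ δ v c y * G i y - outputDensity τ δ (flipAt i v) c y * G i y|
        ≤ ∫ y, r * |outputDensity τ δ v c y - outputDensity τ δ (flipAt i v) c y| := by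
          refine integral_mono_of_nonneg (Filter.Eventually.of_forall fun y => abs_nonneg _)
            (((integrable_outputDensity v c).sub
              (integrable_outputDensity (flipAt i v) c)).abs.const_mul r)
            (Filter.Eventually.of_forall fun y => ?_)
          simp only
          rw [← sub_mul, abs_mul, mul_comm r]
          exact mul_le_mul_of_nonneg_left (hr i y) (abs_nonneg _)
      _ ≤ _ := by
          rw [integral_const_mul]
          exact mul_le_mul_of_nonneg_left (integral_abs_prod_sub_prod_le
            (fun t => integrable_mixDensity τ _ (c t)) (fun t => integrable_mixDensity τ _ (c t))
            (hpos v) (hpos _) (fun t => integral_mixDensity hτ (sum_cubeWeight δ v) (c t))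
            fun t => integral_mixDensity hτ (sum_cubeWeight δ _) (c t)) hr0
  refine (Finset.sum_le_sum fun i _ => hterm i).trans ?_
  rw [← Finset.mul_sum, Finset.sum_add_distrib, Finset.sum_comm]
  refine mul_le_mul_of_nonneg_left (add_le_add (by simp) ?_) hr0
  rw [Finset.mul_sum]
  exact Finset.sum_le_sum fun t _ => sum_hellinger_flipAt_le hτ h0 h1 v (c t)

end Hypercube

/-! ### The law of the channel outputs when the oracle ignores the query. -/

section Transcript

/-- The expectation of a function of public randomness and channel outputs, through the density of
the channel outputs, for inputs that are independent finite-valued symbols. -/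
lemma integral_transcript {κ ι S R : Type*} [Fintype κ] [Fintype ι] [Fintype S]
    [MeasurableSpace S] [MeasurableSingletonClass S] [MeasurableSpace R]
    (μ : Measure (κ → R)) [IsProbabilityMeasure μ] (ν : Measure S) [IsProbabilityMeasure ν]
    (p : S → ℝ) (hp : ∀ s, ν.real {s} = p s) {τ : ℝ≥0} (hτ : τ ≠ 0)
    (c : S → R → ι → ℝ) (hc : Measurable fun x : S × R => c x.1 x.2)
    (F : (κ → R) × (κ → ι → ℝ) → ℝ) (hF : Measurable F) {r : ℝ} (hr : ∀ x, |F x| ≤ r) :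
    Integrable (fun u => ∫ y, (∏ t, mixDensity τ p (fun s => c s (u t)) (y t)) * F (u, y)) μ ∧
    Integrable (fun ω : (κ → R) × (κ → S) × (κ → ι → ℝ) =>
        F (ω.1, fun t i => c (ω.2.1 t) (ω.1 t) i + ω.2.2 t i))
      (μ.prod ((Measure.pi fun _ => ν).prod
        (Measure.pi fun _ => Measure.pi fun _ => gaussianReal 0 τ))) ∧
    ∫ ω : (κ → R) × (κ → S) × (κ → ι → ℝ), F (ω.1, fun t i => c (ω.2.1 t) (ω.1 t) i + ω.2.2 t i)
        ∂(μ.prod ((Measure.pi fun _ => ν).prod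
          (Measure.pi fun _ => Measure.pi fun _ => gaussianReal 0 τ))) =
      ∫ u, (∫ y, (∏ t, mixDensity τ p (fun s => c s (u t)) (y t)) * F (u, y)) ∂μ := by
  classical
  have hy : Measurable fun ω : (κ → R) × (κ → S) × (κ → ι → ℝ) =>
      (ω.1, fun t i => c (ω.2.1 t) (ω.1 t) i + ω.2.2 t i) := by
    refine measurable_fst.prodMk (measurable_pi_lambda _ fun t => measurable_pi_lambda _ fun i => ?_)
    have h1 : Measurable fun ω : (κ → R) × (κ → S) × (κ → ι → ℝ) => (ω.2.1 t, ω.1 t) := by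
      fun_prop
    exact ((measurable_pi_apply i).comp (hc.comp h1)).add (by fun_prop)
  have hm := hF.comp hy
  have hint : Integrable (fun ω : (κ → R) × (κ → S) × (κ → ι → ℝ) =>
        F (ω.1, fun t i => c (ω.2.1 t) (ω.1 t) i + ω.2.2 t i))
      (μ.prod ((Measure.pi fun _ => ν).prod
        (Measure.pi fun _ => Measure.pi fun _ => gaussianReal 0 τ))) :=
    Integrable.of_bound hm.aestronglyMeasurable r (Filter.Eventually.of_forall fun ω => hr _)
  have hinner : ∀ u : κ → R, ∫ x : (κ → S) × (κ → ι → ℝ),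
      F (u, fun t i => c (x.1 t) (u t) i + x.2 t i)
        ∂((Measure.pi fun _ => ν).prod
          (Measure.pi fun _ => Measure.pi fun _ => gaussianReal 0 τ)) =
      ∫ y, (∏ t, mixDensity τ p (fun s => c s (u t)) (y t)) * F (u, y) := by
    intro u
    have hFu : Measurable fun y => F (u, y) := hF.comp measurable_prodMk_left
    have hi : Integrable (fun x : (κ → S) × (κ → ι → ℝ) =>
        F (u, fun t i => c (x.1 t) (u t) i + x.2 t i)) ((Measure.pi fun _ => ν).prod
          (Measure.pi fun _ => Measure.pi fun _ => gaussianReal 0 τ)) :=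
      Integrable.of_bound (hm.comp (measurable_prodMk_left (x := u))).aestronglyMeasurable r
        (Filter.Eventually.of_forall fun ω => hr _)
    rw [integral_prod _ hi, integral_fintype Integrable.of_finite]
    have hw : ∀ w : κ → S, (Measure.pi fun _ : κ => ν).real {w} = ∏ t, p (w t) := by
      intro w
      simp [measureReal_def, ENNReal.toReal_prod, ← hp]
    have hk : ∀ w : κ → S, Integrable fun y : κ → ι → ℝ =>
        (∏ t, gaussDensity τ (c (w t) (u t)) (y t)) * F (u, y) := fun w =>
      (Integrable.fintype_prod fun t => integrable_gaussDensity τ (c (w t) (u t))).mul_bdd (c := r)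
        hFu.aestronglyMeasurable (Filter.Eventually.of_forall fun y => hr _)
    simp_rw [hw, smul_eq_mul]
    calc ∑ w : κ → S, (∏ t, p (w t)) * ∫ z : κ → ι → ℝ,
          F (u, fun t i => c (w t) (u t) i + z t i)
            ∂(Measure.pi fun _ => Measure.pi fun _ => gaussianReal 0 τ)
        = ∑ w : κ → S, ∫ y : κ → ι → ℝ, (∏ t, p (w t)) *
            ((∏ t, gaussDensity τ (c (w t) (u t)) (y t)) * F (u, y)) := by
          refine Finset.sum_congr rfl fun w _ => ?_
          rw [integral_const_mul, ← integral_shift_noise hτ (fun t => c (w t) (u t)) _ hFu]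
      _ = ∫ y : κ → ι → ℝ, ∑ w : κ → S, (∏ t, p (w t)) *
            ((∏ t, gaussDensity τ (c (w t) (u t)) (y t)) * F (u, y)) :=
          (integral_finsetSum _ fun w _ => (hk w).const_mul _).symm
      _ = _ := by
          refine integral_congr_ae (Filter.Eventually.of_forall fun y => ?_)
          simp only [mixDensity]
          -- Independence of the seeds: the product over iterations of mixtures is the mixture over
          -- seed sequences of products.
          rw [Fintype.prod_sum, Finset.sum_mul]
          refine Finset.sum_congr rfl fun w _ => ?_
          rw [Finset.prod_mul_distrib]
          ring
  refine ⟨?_, hint, ?_⟩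
  · have := hint.integral_prod_left
    simp_rw [hinner] at this
    exact this
  · rw [integral_prod _ hint]
    simp_rw [hinner]

end Transcript

/-! ### The hard instances on the cube. -/

section CubeOracle

variable {d : ℕ}

/-- The cube with sides `2 * r`, centred at the origin. -/
def cube (d : ℕ) (r : ℝ) : Set (EuclideanSpace ℝ (Fin d)) := {x | ∀ i, |x i| ≤ r}

lemma isFeasibleSet_cube {r D : ℝ} (hr : 0 ≤ r) (hD : 0 ≤ D) (h : d * (2 * r) ^ 2 ≤ D ^ 2) :
    IsFeasibleSet D (cube d r) where
  nonempty := ⟨0, fun i => by simpa using hr⟩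
  closed := by
    have : cube d r = ⋂ i, {x : EuclideanSpace ℝ (Fin d) | |x i| ≤ r} := by
      ext x; simp [cube]
    rw [this]
    exact isClosed_iInter fun i => isClosed_le (by fun_prop) continuous_const
  convex := by
    intro x hx y hy a b ha hb hab i
    have h1 := abs_le.1 (hx i)
    have h2 := abs_le.1 (hy i)
    simp only [PiLp.add_apply, PiLp.smul_apply, smul_eq_mul, abs_le]
    constructor <;> nlinarith
  diam_le := by
    intro x hx y hy
    refine le_of_sq_le_sq ?_ hD
    rw [EuclideanSpace.norm_sq_eq]
    calc ∑ i, ‖(x - y) i‖ ^ 2 ≤ ∑ _i : Fin d, (2 * r) ^ 2 := by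
          refine Finset.sum_le_sum fun i _ => ?_
          have h1 := abs_le.1 (hx i)
          have h2 := abs_le.1 (hy i)
          rw [Real.norm_eq_abs, sq_abs, PiLp.sub_apply]
          exact sq_le_sq' (by linarith) (by linarith)
      _ ≤ D ^ 2 := by simpa using h

/-- The measure on sign vectors with weights `cubeWeight δ v`. -/
noncomputable def cubeLaw (δ : ℝ) (v : Fin d → Bool) : Measure (Fin d → Bool) :=
  ∑ s, ENNReal.ofReal (cubeWeight δ v s) • Measure.dirac s

lemma cubeLaw_singleton (δ : ℝ) (v s : Fin d → Bool) :
    cubeLaw δ v {s} = ENNReal.ofReal (cubeWeight δ v s) := by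
  simp [cubeLaw, Measure.finsetSum_apply, Set.indicator_apply]

variable {δ : ℝ}

lemma isProbabilityMeasure_cubeLaw (h0 : 0 ≤ δ) (h1 : δ ≤ 1 / 2) (v : Fin d → Bool) :
    IsProbabilityMeasure (cubeLaw δ v) := by
  constructor
  simp only [cubeLaw, Measure.finsetSum_apply, Measure.smul_apply, measure_univ, smul_eq_mul,
    mul_one]
  rw [← ENNReal.ofReal_sum_of_nonneg fun s _ => cubeWeight_nonneg h0 h1 v s, sum_cubeWeight,
    ENNReal.ofReal_one]

lemma cubeLaw_real_singleton (h0 : 0 ≤ δ) (h1 : δ ≤ 1 / 2) (v s : Fin d → Bool) :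
    (cubeLaw δ v).real {s} = cubeWeight δ v s := by
  rw [measureReal_def, cubeLaw_singleton, ENNReal.toReal_ofReal (cubeWeight_nonneg h0 h1 v s)]

/-- The vector with entries of modulus `b` and signs opposite to `s`. -/
noncomputable def signVector (b : ℝ) (s : Fin d → Bool) : EuclideanSpace ℝ (Fin d) :=
  WithLp.toLp 2 fun i => -(b * boolSign (s i))

lemma norm_signVector_sq (b : ℝ) (s : Fin d → Bool) : ‖signVector b s‖ ^ 2 = d * b ^ 2 := by
  rw [EuclideanSpace.norm_sq_eq]
  have : ∀ i, ‖signVector b s i‖ ^ 2 = b ^ 2 := fun i => by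
    simp [signVector, abs_boolSign]
  simp_rw [this]
  simp

lemma integral_signVector (h0 : 0 ≤ δ) (h1 : δ ≤ 1 / 2) (b : ℝ) (v : Fin d → Bool) :
    ∫ s, signVector b s ∂(cubeLaw δ v) = signVector (δ * b) v := by
  have := isProbabilityMeasure_cubeLaw h0 h1 v
  rw [integral_fintype Integrable.of_finite]
  simp_rw [cubeLaw_real_singleton h0 h1]
  ext i
  simp only [signVector, WithLp.ofLp_sum, Finset.sum_apply, PiLp.smul_apply, smul_eq_mul]
  calc ∑ s, cubeWeight δ v s * -(b * boolSign (s i))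
      = -(b * ∑ s, cubeWeight δ v s * boolSign (s i)) := by
        rw [Finset.mul_sum, ← Finset.sum_neg_distrib]
        exact Finset.sum_congr rfl fun s _ => by ring
    _ = _ := by rw [sum_cubeWeight_mul_boolSign]; ring

/-- The linear function with gradient `signVector (δ * b) v` on the cube and the oracle that
answers every query by `signVector b s`, with `s` of law `cubeLaw δ v`. -/
noncomputable def cubeOracle (r : ℝ) {B : ℝ} (h0 : 0 ≤ δ) (h1 : δ ≤ 1 / 2) (b : ℝ)
    (hb : d * b ^ 2 ≤ B ^ 2) (hr : Convex ℝ (cube d r)) (v : Fin d → Bool) :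
    FunctionOracle (cube d r) B :=
  have := isProbabilityMeasure_cubeLaw h0 h1 v
  { f := fun x => inner ℝ (signVector (δ * b) v) x
    convexOn := by
      exact (innerₛₗ ℝ (signVector (δ * b) v)).convexOn hr
    Seed := Fin d → Bool
    seedLaw := cubeLaw δ v
    grad := fun x => signVector b x.2
    measurable_grad := (measurable_of_finite (signVector b)).comp measurable_snd
    unbiased := by
      intro x y hy
      simp only [integral_signVector h0 h1, inner_sub_right]
      linarith
    meanSquare := by
      intro x
      have : ∀ s : Fin d → Bool, ‖signVector b s‖ₑ ^ 2 ≤ ENNReal.ofReal (B ^ 2) := fun s => by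
        rw [← ofReal_norm, ← ENNReal.ofReal_pow (norm_nonneg _), norm_signVector_sq]
        exact ENNReal.ofReal_le_ofReal hb
      refine (lintegral_mono this).trans ?_
      simp }

/-- This removes adaptivity: the recursion through the queries collapses to a formula for each
iteration separately. -/
lemma channelOutputs_of_grad_eq {X : Set (EuclideanSpace ℝ (Fin d))} {B P : ℝ} {N : ℕ}
    (p : Protocol X B P N) (O : FunctionOracle X B) (g : O.Seed → EuclideanSpace ℝ (Fin d))
    (hg : ∀ x w, O.grad (x, w) = g w) (u : Fin p.T → p.R) (w : Fin p.T → O.Seed)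
    (z : Fin p.T → Fin p.ℓ → ℝ) (t : ℕ) (h : t ≤ p.T) :
    channelOutputs p O u w z t h = fun j i =>
      p.encoder (g (w (Fin.castLE h j)), u (Fin.castLE h j)) i + z (Fin.castLE h j) i := by
  induction t with
  | zero => ext j; exact j.elim0
  | succ t ih =>
    ext j i
    simp only [channelOutputs, hg, ih]
    refine Fin.lastCases ?_ (fun k => ?_) j
    · simp only [Fin.snoc_last]; rfl
    · simp only [Fin.snoc_castSucc]; rfl

end CubeOracle

/-! ### Assouad's argument for an arbitrary protocol. -/

section LowerBound

variable {d N : ℕ} {B P : ℝ}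

/-- Averaging over all sign vectors: one of them correlates badly with the estimate `e`. -/
lemma exists_sum_boolSign_mul_le (e : (Fin d → Bool) → Fin d → ℝ) {M : ℝ}
    (h : ∀ v, ∑ i, boolSign (v i) * (e v i - e (flipAt i v) i) ≤ 2 * M) :
    ∃ v, ∑ i, boolSign (v i) * e v i ≤ M := by
  -- Flipping permutes the sign vectors and negates the `i`-th sign, so the flipped terms double the
  -- average instead of cancelling it.
  have hflip : ∀ i, ∑ v, boolSign (v i) * e (flipAt i v) i = -∑ v, boolSign (v i) * e v i := by
    intro i
    rw [← (flipAt_involutive i).bijective.sum_comp fun v => boolSign (v i) * e v i,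
      ← Finset.sum_neg_distrib]
    refine Finset.sum_congr rfl fun v _ => ?_
    simp [flipAt, boolSign_not]
  have hsum : ∑ v, ∑ i, boolSign (v i) * (e v i - e (flipAt i v) i) =
      2 * ∑ v, ∑ i, boolSign (v i) * e v i := by
    rw [Finset.sum_comm, Finset.sum_comm (γ := Fin d → Bool) (f := fun v i => boolSign (v i) * e v i),
      Finset.mul_sum]
    refine Finset.sum_congr rfl fun i _ => ?_
    simp_rw [mul_sub]
    rw [Finset.sum_sub_distrib, hflip]
    ring
  by_contra! hcon
  have h1 : ∑ _v : Fin d → Bool, M < ∑ v, ∑ i, boolSign (v i) * e v i :=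
    Finset.sum_lt_sum_of_nonempty Finset.univ_nonempty fun v _ => hcon v
  have h2 : ∑ v, ∑ i, boolSign (v i) * (e v i - e (flipAt i v) i) ≤
      ∑ _v : Fin d → Bool, 2 * M := Finset.sum_le_sum fun v _ => h v
  rw [hsum, ← Finset.mul_sum] at h2
  linarith

variable {X : Set (EuclideanSpace ℝ (Fin d))}

/-- A point mass is an admissible gradient law, so the power constraint holds for each fixed
gradient, averaged over the public randomness only. -/
lemma Protocol.integrable_norm_encoder_sq (p : Protocol X B P N) (hP : 0 ≤ P) (t : Fin p.T)
    {g : EuclideanSpace ℝ (Fin d)} (hg : ‖g‖ ^ 2 ≤ B ^ 2) :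
    Integrable (fun u => ‖p.encoder (g, u t)‖ ^ 2) p.randLaw ∧
      ∫ u, ‖p.encoder (g, u t)‖ ^ 2 ∂p.randLaw ≤ p.ℓ * P := by
  have hm : Measurable fun u : Fin p.T → p.R => ‖p.encoder (g, u t)‖ ^ 2 :=
    (p.measurable_encoder.comp (measurable_prodMk_left.comp (measurable_pi_apply t))).norm.pow_const 2
  have hen : ∀ {m : ℕ} (x : EuclideanSpace ℝ (Fin m)), ‖x‖ₑ ^ 2 = ENNReal.ofReal (‖x‖ ^ 2) :=
    fun x => by rw [← ofReal_norm, ENNReal.ofReal_pow (norm_nonneg _)]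
  have h := p.power t (Measure.dirac g) inferInstance (by
    rw [lintegral_dirac, hen]
    exact ENNReal.ofReal_le_ofReal hg)
  have hme : Measurable fun ρ : p.R => ‖p.encoder (g, ρ)‖ₑ ^ 2 :=
    (p.measurable_encoder.comp measurable_prodMk_left).enorm.pow_const 2
  rw [lintegral_dirac, lintegral_map hme (measurable_pi_apply t)] at h
  simp_rw [hen] at h
  have hnn : 0 ≤ᵐ[p.randLaw] fun u => ‖p.encoder (g, u t)‖ ^ 2 :=
    Filter.Eventually.of_forall fun u => sq_nonneg _
  refine ⟨⟨hm.aestronglyMeasurable, ?_⟩, ?_⟩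
  · rw [hasFiniteIntegral_iff_ofReal hnn]
    exact h.trans_lt ENNReal.ofReal_lt_top
  · rw [integral_eq_lintegral_of_nonneg_ae hnn hm.aestronglyMeasurable]
    exact ENNReal.toReal_le_of_le_ofReal (by positivity) h

/-- The code of the protocol for sign vectors with entries of modulus `b`. -/
noncomputable def Protocol.signCode (p : Protocol X B P N) (b : ℝ) (u : Fin p.T → p.R) (t : Fin p.T)
    (s : Fin d → Bool) (i : Fin p.ℓ) : ℝ :=
  p.encoder (signVector b s, u t) i

/-- The expectation of the `i`-th coordinate of the output of the protocol when the oracle answers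
by sign vectors of law `cubeLaw δ v`. -/
noncomputable def Protocol.meanOutput (p : Protocol X B P N) (τ : ℝ≥0) (δ b : ℝ) (v : Fin d → Bool)
    (i : Fin d) : ℝ :=
  ∫ u, (∫ y, outputDensity τ δ v (p.signCode b u) y *
    (p.output (u, y) : EuclideanSpace ℝ (Fin d)) i) ∂p.randLaw

lemma Protocol.measurable_output_apply (p : Protocol X B P N) (i : Fin d) :
    Measurable fun x => (p.output x : EuclideanSpace ℝ (Fin d)) i := by
  have h : Measurable fun x => (p.output x : EuclideanSpace ℝ (Fin d)) :=
    measurable_subtype_coe.comp p.measurable_output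
  fun_prop

variable {r δ : ℝ} {τ : ℝ≥0}

/-- The output of the protocol in a run with a sign vector oracle. -/
lemma Protocol.integral_signOutput (p : Protocol (cube d r) B P N) (hτ : τ ≠ 0) (h0 : 0 ≤ δ)
    (h1 : δ ≤ 1 / 2) (b : ℝ) (v : Fin d → Bool) (i : Fin d) :
    Integrable (fun u => ∫ y, outputDensity τ δ v (p.signCode b u) y *
      (p.output (u, y) : EuclideanSpace ℝ (Fin d)) i) p.randLaw ∧
    Integrable (fun ω : (Fin p.T → p.R) × (Fin p.T → Fin d → Bool) × (Fin p.T → Fin p.ℓ → ℝ) =>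
        (p.output (ω.1, fun t j => p.encoder (signVector b (ω.2.1 t), ω.1 t) j + ω.2.2 t j) :
          EuclideanSpace ℝ (Fin d)) i)
      (p.randLaw.prod ((Measure.pi fun _ => cubeLaw δ v).prod
        (Measure.pi fun _ => Measure.pi fun _ => gaussianReal 0 τ))) ∧
    ∫ ω : (Fin p.T → p.R) × (Fin p.T → Fin d → Bool) × (Fin p.T → Fin p.ℓ → ℝ),
        (p.output (ω.1, fun t j => p.encoder (signVector b (ω.2.1 t), ω.1 t) j + ω.2.2 t j) :
          EuclideanSpace ℝ (Fin d)) i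
        ∂(p.randLaw.prod ((Measure.pi fun _ => cubeLaw δ v).prod
          (Measure.pi fun _ => Measure.pi fun _ => gaussianReal 0 τ))) =
      p.meanOutput τ δ b v i := by
  have := isProbabilityMeasure_cubeLaw h0 h1 v
  have hc : Measurable fun x : (Fin d → Bool) × p.R =>
      (fun j => p.encoder (signVector b x.1, x.2) j : Fin p.ℓ → ℝ) := by
    have h : Measurable fun x : (Fin d → Bool) × p.R => p.encoder (signVector b x.1, x.2) :=
      p.measurable_encoder.comp
        (((measurable_of_finite (signVector b)).comp measurable_fst).prodMk measurable_snd)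
    fun_prop
  exact integral_transcript p.randLaw (cubeLaw δ v) (cubeWeight δ v)
    (cubeLaw_real_singleton h0 h1 v) hτ (fun s ρ j => p.encoder (signVector b s, ρ) j) hc
    (fun x => (p.output x : EuclideanSpace ℝ (Fin d)) i) (p.measurable_output_apply i)
    fun x => (p.output x).2 i

/-- With an integrable majorant `β`, the measurability in `u` of the score information itself never
has to be discussed. -/
lemma Protocol.sum_meanOutput_sub_le_integral (p : Protocol (cube d r) B P N) (hτ : τ ≠ 0) (h0 : 0 ≤ δ)
    (h1 : δ ≤ 1 / 2) (b : ℝ) (v : Fin d → Bool) {β : (Fin p.T → p.R) → ℝ}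
    (hβ : Integrable β p.randLaw) (hr : 0 ≤ r)
    (h : ∀ u, r * (d + δ ^ 2 * ∑ t, scoreInformation τ δ v (p.signCode b u t)) ≤ β u) :
    ∑ i, boolSign (v i) * (p.meanOutput τ δ b v i - p.meanOutput τ δ b (flipAt i v) i) ≤
      ∫ u, β u ∂p.randLaw := by
  have hi := fun v i => (p.integral_signOutput hτ h0 h1 b v i).1
  have hs : ∀ i, Integrable (fun u => boolSign (v i) *
      ((∫ y, outputDensity τ δ v (p.signCode b u) y *
        (p.output (u, y) : EuclideanSpace ℝ (Fin d)) i) -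
      ∫ y, outputDensity τ δ (flipAt i v) (p.signCode b u) y *
        (p.output (u, y) : EuclideanSpace ℝ (Fin d)) i)) p.randLaw := fun i =>
    ((hi v i).sub (hi (flipAt i v) i)).const_mul _
  have heq : ∑ i, boolSign (v i) * (p.meanOutput τ δ b v i - p.meanOutput τ δ b (flipAt i v) i) =
      ∫ u, ∑ i, boolSign (v i) * ((∫ y, outputDensity τ δ v (p.signCode b u) y *
        (p.output (u, y) : EuclideanSpace ℝ (Fin d)) i) -
      ∫ y, outputDensity τ δ (flipAt i v) (p.signCode b u) y *
        (p.output (u, y) : EuclideanSpace ℝ (Fin d)) i) ∂p.randLaw := by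
    rw [integral_finsetSum _ fun i _ => hs i]
    refine Finset.sum_congr rfl fun i _ => ?_
    rw [integral_const_mul, integral_sub (hi v i) (hi _ i)]
    rfl
  rw [heq]
  refine integral_mono (integrable_finsetSum _ fun i _ => hs i) hβ fun u => ?_
  exact (sum_boolSign_mul_integral_sub_le hτ h0 h1 v (p.signCode b u)
    (fun i y => (p.output (u, y) : EuclideanSpace ℝ (Fin d)) i)
    (fun i => (p.measurable_output_apply i).comp measurable_prodMk_left) hr
    fun i y => (p.output (u, y)).2 i).trans (h u)

lemma Protocol.sum_meanOutput_sub_le_dim (p : Protocol (cube d r) B P N) (hτ : τ ≠ 0) (h0 : 0 ≤ δ)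
    (h1 : δ ≤ 1 / 2) (b : ℝ) (v : Fin d → Bool) (hr : 0 ≤ r) :
    ∑ i, boolSign (v i) * (p.meanOutput τ δ b v i - p.meanOutput τ δ b (flipAt i v) i) ≤
      r * (d + δ ^ 2 * (p.T * (16 * d))) := by
  refine (p.sum_meanOutput_sub_le_integral hτ h0 h1 b v (integrable_const
    (r * (d + δ ^ 2 * (p.T * (16 * d))))) hr fun u => ?_).trans_eq (by simp)
  have : ∑ t, scoreInformation τ δ v (p.signCode b u t) ≤ ∑ _t : Fin p.T, (16 * d : ℝ) :=
    Finset.sum_le_sum fun t _ => scoreInformation_le_dim hτ h0 h1 v _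
  simp only [Finset.sum_const, Finset.card_univ, Fintype.card_fin, nsmul_eq_mul] at this
  gcongr

lemma Protocol.sum_meanOutput_sub_le_capacity (p : Protocol (cube d r) B P N) (hτ : τ ≠ 0)
    (h0 : 0 ≤ δ) (h1 : δ ≤ 1 / 2) {b : ℝ} (hb : d * b ^ 2 ≤ B ^ 2) (v : Fin d → Bool)
    (hr : 0 ≤ r) (hP : 0 ≤ P) :
    ∑ i, boolSign (v i) * (p.meanOutput τ δ b v i - p.meanOutput τ δ b (flipAt i v) i) ≤
      r * (d + δ ^ 2 * (p.T * (32 * (p.ℓ * Real.log (1 + P / τ))))) := by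
  set w : ℝ≥0 := τ + P.toNNReal with hwdef
  have hτ0 : (0 : ℝ) < τ := NNReal.coe_pos.2 (pos_iff_ne_zero.2 hτ)
  have hw : w ≠ 0 := by
    intro h
    exact hτ (add_eq_zero.1 h).1
  have hwc : (w : ℝ) = τ + P := by simp [hwdef, hP]
  have hw0 : (0 : ℝ) < w := NNReal.coe_pos.2 (pos_iff_ne_zero.2 hw)
  have hlog : (w : ℝ) / τ = 1 + P / τ := by rw [hwc]; field_simp
  have hpw := fun t s => p.integrable_norm_encoder_sq hP t
    (g := signVector b s) ((norm_signVector_sq b s).trans_le hb)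
  set power : Fin p.T → (Fin p.T → p.R) → ℝ := fun t u =>
    ∑ s, cubeWeight δ v s * ‖p.encoder (signVector b s, u t)‖ ^ 2 with hpower
  have hpi : ∀ t, Integrable (power t) p.randLaw := fun t =>
    integrable_finsetSum _ fun s _ => (hpw t s).1.const_mul _
  have hple : ∀ t, ∫ u, power t u ∂p.randLaw ≤ p.ℓ * P := by
    intro t
    rw [hpower, integral_finsetSum _ fun s _ => (hpw t s).1.const_mul _]
    calc ∑ s, ∫ u, cubeWeight δ v s * ‖p.encoder (signVector b s, u t)‖ ^ 2 ∂p.randLaw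
        ≤ ∑ s, cubeWeight δ v s * (p.ℓ * P) := by
          refine Finset.sum_le_sum fun s _ => ?_
          rw [integral_const_mul]
          exact mul_le_mul_of_nonneg_left (hpw t s).2 (cubeWeight_nonneg h0 h1 v s)
      _ = p.ℓ * P := by rw [← Finset.sum_mul, sum_cubeWeight, one_mul]
  have hti : ∀ t, Integrable (fun u => 2 * 32 * (p.ℓ / 2 * Real.log (1 + P / τ) +
      (power t u - p.ℓ * P) / (2 * w))) p.randLaw := fun t =>
    ((integrable_const _).add (((hpi t).sub (integrable_const _)).div_const _)).const_mul _
  have htle : ∀ t, ∫ u, 2 * 32 * (p.ℓ / 2 * Real.log (1 + P / τ) +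
      (power t u - p.ℓ * P) / (2 * w)) ∂p.randLaw ≤ 32 * (p.ℓ * Real.log (1 + P / τ)) := by
    intro t
    have hsub : Integrable (fun u => power t u - p.ℓ * P) p.randLaw :=
      (hpi t).sub (integrable_const _)
    rw [integral_const_mul, integral_add (integrable_const _) (hsub.div_const _), integral_div,
      integral_sub (hpi t) (integrable_const _)]
    simp only [integral_const, probReal_univ, smul_eq_mul, one_mul]
    -- A single draw of `u` may overspend; the sign is guaranteed only after integration over `u`.
    have : (∫ u, power t u ∂p.randLaw - p.ℓ * P) / (2 * w) ≤ 0 :=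
      div_nonpos_of_nonpos_of_nonneg (by linarith [hple t]) (by positivity)
    linarith
  have hsi : Integrable (fun u => ∑ t, 2 * 32 * (p.ℓ / 2 * Real.log (1 + P / τ) +
      (power t u - p.ℓ * P) / (2 * w))) p.randLaw := integrable_finsetSum _ fun t _ => hti t
  have hdi : Integrable (fun u => d + δ ^ 2 * ∑ t, 2 * 32 * (p.ℓ / 2 * Real.log (1 + P / τ) +
      (power t u - p.ℓ * P) / (2 * w))) p.randLaw :=
    (integrable_const _).add (hsi.const_mul _)
  refine (p.sum_meanOutput_sub_le_integral hτ h0 h1 b v (hdi.const_mul r) hr fun u => ?_).trans ?_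
  · refine mul_le_mul_of_nonneg_left (add_le_add_right (mul_le_mul_of_nonneg_left
      (Finset.sum_le_sum fun t _ => ?_) (sq_nonneg δ)) _) hr
    refine (scoreInformation_le_capacity hτ hw h0 h1 v (p.signCode b u t)).trans_eq ?_
    have hn : ∀ s, ∑ i, p.signCode b u t s i ^ 2 = ‖p.encoder (signVector b s, u t)‖ ^ 2 := by
      intro s
      rw [EuclideanSpace.norm_sq_eq]
      simp [Protocol.signCode]
    simp_rw [hn, Fintype.card_fin]
    rw [hlog, show (w : ℝ) - τ = P by rw [hwc]; ring]
  · rw [integral_const_mul, integral_add (integrable_const _) (hsi.const_mul _),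
      integral_const_mul, integral_finsetSum _ fun t _ => hti t]
    simp only [integral_const, probReal_univ, smul_eq_mul, one_mul]
    refine mul_le_mul_of_nonneg_left (add_le_add_right (mul_le_mul_of_nonneg_left
      ((Finset.sum_le_sum fun t _ => htle t).trans_eq ?_) (sq_nonneg δ)) _) hr
    simp

/-- The convergence error with a sign vector oracle, through the correlation of the output with the
signs. -/
lemma Protocol.le_convergenceError_cubeOracle (p : Protocol (cube d r) B P N) {σ : ℝ} (hσ : 0 < σ)
    (h0 : 0 ≤ δ) (h1 : δ ≤ 1 / 2) {b : ℝ} (hb0 : 0 ≤ b) (hb : d * b ^ 2 ≤ B ^ 2) (hr0 : 0 ≤ r)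
    (hr : Convex ℝ (cube d r)) (v : Fin d → Bool) :
    δ * b * (d * r - ∑ i, boolSign (v i) * p.meanOutput (σ ^ 2).toNNReal δ b v i) ≤
      convergenceError p (cubeOracle r h0 h1 b hb hr v) σ := by
  set O := cubeOracle r h0 h1 b hb hr v with hO
  have hτ : (σ ^ 2).toNNReal ≠ 0 := by
    simpa using hσ.ne'
  have hinner : ∀ x : EuclideanSpace ℝ (Fin d), O.f x = -(δ * b) * ∑ i, boolSign (v i) * x i := by
    intro x
    change inner ℝ (signVector (δ * b) v) x = _
    rw [PiLp.inner_apply, Finset.mul_sum]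
    refine Finset.sum_congr rfl fun i _ => ?_
    simp [signVector]
    ring
  have hfin : ∀ ω, finalPoint p O ω = p.output (ω.1,
      fun t j => p.encoder (signVector b (ω.2.1 t), ω.1 t) j + ω.2.2 t j) := by
    intro ω
    rw [finalPoint, channelOutputs_of_grad_eq p O (signVector b) (fun _ _ => rfl)]
    rfl
  have hI : ∫ ω, O.f (finalPoint p O ω) ∂(runLaw p O σ) =
      -(δ * b) * ∑ i, boolSign (v i) * p.meanOutput (σ ^ 2).toNNReal δ b v i := by
    simp_rw [hinner, hfin]
    rw [integral_const_mul]
    congr 1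
    have hs := fun i => p.integral_signOutput hτ h0 h1 b v i
    have hsum := integral_finsetSum Finset.univ fun i _ => (hs i).2.1.const_mul (boolSign (v i))
    refine hsum.trans (Finset.sum_congr rfl fun i _ => ?_)
    rw [integral_const_mul, (hs i).2.2]
  have hinf : ⨅ x : cube d r, O.f x ≤ -(δ * b) * (d * r) := by
    -- The minimizing corner is `r` times the signs `v`; the negative radius undoes the minus sign
    -- in `signVector`.
    have hmem : signVector (-r) v ∈ cube d r := by
      intro i
      simp [signVector, abs_mul, abs_boolSign, abs_of_nonneg hr0]
    have hbdd : BddBelow (Set.range fun x : cube d r => O.f x) := by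
      refine ⟨-(δ * b) * (d * r), ?_⟩
      rintro _ ⟨x, rfl⟩
      simp only [hinner]
      refine mul_le_mul_of_nonpos_left ?_ (by nlinarith [mul_nonneg h0 hb0])
      calc ∑ i, boolSign (v i) * (x : EuclideanSpace ℝ (Fin d)) i ≤ ∑ _i : Fin d, r := by
            refine Finset.sum_le_sum fun i _ => (le_abs_self _).trans ?_
            rw [abs_mul, abs_boolSign, one_mul]
            exact x.2 i
        _ = d * r := by simp
    refine (ciInf_le hbdd ⟨_, hmem⟩).trans_eq ?_
    rw [hinner]
    congr 1
    have : ∀ i, boolSign (v i) * signVector (-r) v i = r := by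
      intro i
      cases h : v i <;> simp [signVector, boolSign, h]
    simp_rw [this]
    simp
  rw [convergenceError, hI]
  linarith

end LowerBound

/-- Every protocol on the cube errs by a constant multiple of `D * B * δ` with some oracle, when
the bias `δ` is too small to be detected through `N` uses of the channel. -/
lemma exists_oracle_le_convergenceError {d N : ℕ} {D B P σ δ r : ℝ} (hd : 1 ≤ d) (hD : 0 < D)
    (hB : 0 < B) (hP : 0 < P) (hσ : 0 < σ) (h0 : 0 ≤ δ) (h1 : δ ≤ 1 / 2)
    (hδ : 128 * (δ ^ 2 * (N * min (d : ℝ) (1 / 2 * Real.logb 2 (1 + P / σ ^ 2)))) ≤ d)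
    (hr : r = D / (2 * √d)) (hX : IsFeasibleSet D (cube d r)) (p : Protocol (cube d r) B P N) :
    ∃ O : FunctionOracle (cube d r) B, D * B * δ / 8 ≤ convergenceError p O σ := by
  have hd0 : (0 : ℝ) < d := by exact_mod_cast hd
  have hsd : 0 < √(d : ℝ) := Real.sqrt_pos.2 hd0
  have hsq : √(d : ℝ) ^ 2 = d := Real.sq_sqrt hd0.le
  have hr0 : 0 < r := hr ▸ by positivity
  set b := B / √d with hb
  have hb0 : 0 < b := by positivity
  have hbB : d * b ^ 2 ≤ B ^ 2 := by
    rw [hb, div_pow, hsq, mul_div_cancel₀ _ hd0.ne']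
  set L := Real.logb 2 (1 + P / σ ^ 2) with hL
  have hτ : (σ ^ 2).toNNReal ≠ 0 := by simpa using hσ.ne'
  have hτc : (((σ ^ 2).toNNReal : ℝ≥0) : ℝ) = σ ^ 2 := by simp [sq_nonneg]
  have hsnr : 1 < 1 + P / σ ^ 2 := by
    have : 0 < P / σ ^ 2 := by positivity
    linarith
  have hL0 : 0 < L := Real.logb_pos (by norm_num) hsnr
  have hlogL : Real.log (1 + P / σ ^ 2) ≤ L := by
    rw [hL, Real.logb, le_div_iff₀ (Real.log_pos (by norm_num))]
    have h2 : Real.log 2 ≤ 1 := by linarith [Real.log_two_lt_d9]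
    nlinarith [Real.log_pos hsnr]
  have huse : (p.ℓ : ℝ) * p.T ≤ N := by exact_mod_cast p.channelUses
  have hpair : ∀ v, ∑ i, boolSign (v i) * (p.meanOutput (σ ^ 2).toNNReal δ b v i -
      p.meanOutput (σ ^ 2).toNNReal δ b (flipAt i v) i) ≤ 2 * (3 / 4 * (d * r)) := by
    intro v
    suffices h : ∃ I : ℝ, δ ^ 2 * I ≤ d / 2 ∧ ∑ i, boolSign (v i) *
        (p.meanOutput (σ ^ 2).toNNReal δ b v i -
          p.meanOutput (σ ^ 2).toNNReal δ b (flipAt i v) i) ≤ r * (d + δ ^ 2 * I) by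
      obtain ⟨I, hI, h⟩ := h
      nlinarith [mul_le_mul_of_nonneg_left hI hr0.le]
    -- The dimension bound needs `T ≤ N`, hence `ℓ ≥ 1`. For `ℓ = 0` the number of queries is
    -- unrestricted, but the capacity bound is zero. The factor 128 in `hδ` is what the capacity
    -- case needs: `64 δ² N L ≤ d` gives `32 δ² N L ≤ d / 2`.
    by_cases hcase : p.ℓ ≠ 0 ∧ (d : ℝ) ≤ 1 / 2 * L
    · refine ⟨_, ?_, p.sum_meanOutput_sub_le_dim hτ h0 h1 b v hr0.le⟩
      rw [min_eq_left hcase.2] at hδ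
      have hℓ : (1 : ℝ) ≤ p.ℓ := by exact_mod_cast Nat.one_le_iff_ne_zero.2 hcase.1
      have hT : (p.T : ℝ) ≤ N := by nlinarith [Nat.cast_nonneg (α := ℝ) p.T]
      have : δ ^ 2 * (p.T * d) ≤ δ ^ 2 * (N * d) := by gcongr
      nlinarith
    · refine ⟨_, ?_, p.sum_meanOutput_sub_le_capacity hτ h0 h1 hbB v hr0.le hP.le⟩
      rw [hτc]
      by_cases hℓ : p.ℓ = 0
      · simp only [hℓ, Nat.cast_zero, zero_mul, mul_zero]
        positivity
      · rw [min_eq_right (not_le.1 fun h => hcase ⟨hℓ, h⟩).le] at hδ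
        have : δ ^ 2 * (p.T * (32 * (p.ℓ * Real.log (1 + P / σ ^ 2)))) ≤
            δ ^ 2 * (32 * (N * L)) := by
          refine mul_le_mul_of_nonneg_left ?_ (sq_nonneg δ)
          calc (p.T : ℝ) * (32 * (p.ℓ * Real.log (1 + P / σ ^ 2)))
              = 32 * (p.ℓ * p.T * Real.log (1 + P / σ ^ 2)) := by ring
            _ ≤ 32 * (N * L) := by
                have := Real.log_pos hsnr
                gcongr
        nlinarith
  obtain ⟨v, hv⟩ := exists_sum_boolSign_mul_le _ hpair
  refine ⟨cubeOracle r h0 h1 b hbB hX.convex v, le_trans ?_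
    (p.le_convergenceError_cubeOracle hσ h0 h1 hb0.le hbB hr0.le hX.convex v)⟩
  -- At most `3/4` of the maximal correlation `d * r` is achieved, so the error is at least `δ / 4`
  -- times this product.
  have hbr : b * (d * r) = D * B / 2 := by
    rw [hb, hr]
    field_simp
    rw [hsq]
  have hδb : 0 ≤ δ * b := mul_nonneg h0 hb0.le
  have h2 : δ * b * (d * r / 4) ≤
      δ * b * (d * r - ∑ i, boolSign (v i) * p.meanOutput (σ ^ 2).toNNReal δ b v i) :=
    mul_le_mul_of_nonneg_left (by linarith) hδb
  refine le_trans (le_of_eq ?_) h2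
  rw [show δ * b * (d * r / 4) = δ / 4 * (b * (d * r)) by ring, hbr]
  ring

end OverTheAir

/-! ### Choice of the bias and of the constant. -/

open OverTheAir in
theorem theorem1 :
    ∃ c : ℝ, 0 < c ∧ c < 1 ∧
      ∀ (d : ℕ) (D B P σ : ℝ) (N : ℕ), 1 ≤ d → 0 < D → 0 < B → 0 < P → 0 < σ →
        (d : ℝ) / Real.logb 2 (1 + P / σ ^ 2) ≤ N →
        ((c * D * B / √(N : ℝ) *
            √((d : ℝ) / min (d : ℝ) (1 / 2 * Real.logb 2 (1 + P / σ ^ 2))) : ℝ) : EReal)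
          ≤ OverTheAir.minmaxError d D B P σ N := by
  refine ⟨1 / 100, by norm_num, by norm_num, fun d D B P σ N hd hD hB hP hσ hN => ?_⟩
  have hd0 : (0 : ℝ) < d := by exact_mod_cast hd
  have hsnr : 1 < 1 + P / σ ^ 2 := by
    have : 0 < P / σ ^ 2 := by positivity
    linarith
  set L := Real.logb 2 (1 + P / σ ^ 2) with hL
  have hL0 : 0 < L := Real.logb_pos (by norm_num) hsnr
  have hN0 : (0 : ℝ) < N := (div_pos hd0 hL0).trans_le hN
  have hN1 : (1 : ℝ) ≤ N := by exact_mod_cast hN0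
  have hNL : (d : ℝ) ≤ N * L := (div_le_iff₀ hL0).1 hN
  set m := min (d : ℝ) (1 / 2 * L) with hm
  have hm0 : 0 < m := lt_min hd0 (by positivity)
  -- The lower bound on `N` enters here: it gives `δ² ≤ 1/64`, so that `δ` is an admissible bias.
  have hNm : (d : ℝ) ≤ 2 * (N * m) := by
    rcases min_choice (d : ℝ) (1 / 2 * L) with h | h <;> rw [hm, h] <;> nlinarith
  set δ := √(d / (N * m) / 128) with hδdef
  have hδ2 : δ ^ 2 = d / (N * m) / 128 := Real.sq_sqrt (by positivity)
  have h0 : 0 ≤ δ := Real.sqrt_nonneg _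
  have hx : (d : ℝ) / (N * m) ≤ 2 := (div_le_iff₀ (by positivity)).2 hNm
  have h1 : δ ≤ 1 / 2 := by nlinarith
  have hδ : 128 * (δ ^ 2 * (N * m)) ≤ d := by
    rw [hδ2]
    exact le_of_eq (by field_simp)
  have hX : IsFeasibleSet D (cube d (D / (2 * √d))) := by
    refine isFeasibleSet_cube (by positivity) hD.le (le_of_eq ?_)
    have hsd : 0 < √(d : ℝ) := Real.sqrt_pos.2 hd0
    rw [show 2 * (D / (2 * √(d : ℝ))) = D / √d by field_simp, div_pow, Real.sq_sqrt hd0.le,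
      mul_div_cancel₀ _ hd0.ne']
  have hbound : 1 / 100 * D * B / √(N : ℝ) * √((d : ℝ) / m) ≤ D * B * δ / 8 := by
    have h2 : √((d : ℝ) / m) / √(N : ℝ) = √(128 : ℝ) * δ := by
      rw [hδdef, ← Real.sqrt_mul (by norm_num), ← Real.sqrt_div (by positivity)]
      congr 1
      field_simp
    -- The constant `1 / 100` is a round value below `1 / (8 √128)`.
    have h3 : √(128 : ℝ) ≤ 25 / 2 := Real.sqrt_le_iff.2 ⟨by norm_num, by norm_num⟩
    calc 1 / 100 * D * B / √(N : ℝ) * √((d : ℝ) / m)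
        = D * B / 100 * (√((d : ℝ) / m) / √(N : ℝ)) := by ring
      _ = D * B / 100 * (√(128 : ℝ) * δ) := by rw [h2]
      _ ≤ D * B / 100 * (25 / 2 * δ) := by gcongr
      _ = D * B * δ / 8 := by ring
  refine le_trans ?_ (le_iSup₂_of_le (cube d (D / (2 * √d))) hX le_rfl)
  refine le_iInf fun p => ?_
  obtain ⟨O, hO⟩ := exists_oracle_le_convergenceError hd hD hB hP hσ h0 h1 hδ rfl hX p
  exact le_iSup_of_le O (EReal.coe_le_coe_iff.2 (hbound.trans hO))
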